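/- **Theorem.** Fix a real number $\ell\ge -\tfrac12$. Let $V_1,V_2:(0,\infty)\to\mathbb R$ be measurable potentials such that, for $i=1,2$, $$\int_0^{a} r\,|V_i(r)|\,dr<\infty \quad (0<a<\infty),\qquad \int_b^{\infty}|V_i(r)|\,dr<\infty\quad (b>0),$$ and such that $V_i$ is equal (almost everywhere) to a constant on some interval $(0,\delta_i)$, $\delta_i>0$. For a potential $V$ and an energy $E\in\mathbb R$, the regular solution $\psi_\ell(E,\cdot)$ is the real solution on $(0,\infty)$ of $$\psi''(r)+\Bigl(E-V(r)-\frac{(\ell+1/2)^2-1/4}{r^2}\Bigr)\psi(r)=0,\qquad \lim_{r\to0^+}\psi(r)\,r^{-\ell-1}=1,$$ where $\psi$ is differentiable, $\psi'$ is locally absolutely continuous on $(0,\infty)$, and the equation holds almost everywhere. For an integer $n\ge1$, let $r_n(\ell,E)$ be the $n$-th zero, in increasing order, of $\psi_\ell(E,\cdot)$ in $(0,\infty)$, for those $E\in\mathbb R$ for which there are at least $n$ zeros. The $n$-th line of zeros for $V$ is the graph of $E\mapsto r_n(\ell,E)$, i.e. the set of all pairs $(E,r_n(\ell,E))$. Suppose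 that there are integers $n_1,n_2\ge1$ such that the $n_1$-th line of zeros for $V_1$ coincides with the $n_2$-th line of zeros for $V_2$, and that both lines describe the whole positive axis, i.e. each $r>0$ is the second coordinate of some point of the line. Then $V_1=V_2$ almost everywhere on $(0,\infty)$. -/

import Mathlib

open MeasureTheory Set Filter Topology

namespace FixedEll

/-- The integrability conditions on a potential on the half-line:
`∫₀ᵃ r |V(r)| dr < ∞` for all `0 < a < ∞`, and `∫_b^∞ |V(r)| dr < ∞` for all `b > 0`. -/
def IntegrabilityConditions (V : ℝ → ℝ) : Prop :=
  (∀ a : ℝ, 0 < a → IntegrableOn (fun r => r * V r) (Ioc 0 a)) ∧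
    ∀ b : ℝ, 0 < b → IntegrableOn V (Ioi b)

/-- `V` is (almost everywhere) equal to a constant on some interval `(0, δ)`. -/
def ConstantNearZero (V : ℝ → ℝ) : Prop :=
  ∃ c δ : ℝ, 0 < δ ∧ ∀ᵐ r ∂(volume.restrict (Ioo 0 δ)), V r = c

/-- `ψ` solves, on `(0, ∞)` and in the sense of Carathéodory, the radial Schrödinger equation
`ψ'' + (E - V(r) - ((ℓ + 1/2)² - 1/4) / r²) ψ = 0`:
`ψ` is differentiable, `ψ'` is locally absolutely continuous, and the equation holds a.e. -/
structure IsRadialSolution (V : ℝ → ℝ) (ℓ E : ℝ) (ψ : ℝ → ℝ) : Prop where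
  differentiableAt : ∀ r : ℝ, 0 < r → DifferentiableAt ℝ ψ r
  absolutelyContinuous : ∀ a b : ℝ, 0 < a → a ≤ b →
    AbsolutelyContinuousOnInterval (deriv ψ) a b
  equation : ∀ᵐ r ∂(volume.restrict (Ioi (0 : ℝ))),
    HasDerivAt (deriv ψ) (-(E - V r - ((ℓ + 1 / 2) ^ 2 - 1 / 4) / r ^ 2) * ψ r) r

/-- The regular solution at energy `E`: a solution with `ψ(r) r^(-ℓ-1) → 1` as `r → 0⁺`. -/
structure IsRegularSolution (V : ℝ → ℝ) (ℓ E : ℝ) (ψ : ℝ → ℝ) : Prop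
    extends IsRadialSolution V ℓ E ψ where
  cauchy : Tendsto (fun r : ℝ => ψ r * r ^ (-ℓ - 1)) (𝓝[>] 0) (𝓝 1)

/-- `r` is the `n`-th zero of `ψ` on `(0, ∞)` in increasing order, counted from `n = 1`. -/
def IsNthZero (ψ : ℝ → ℝ) (n : ℕ) (r : ℝ) : Prop :=
  0 < r ∧ ψ r = 0 ∧ {s : ℝ | 0 < s ∧ s ≤ r ∧ ψ s = 0}.encard = n

/-- The `n`-th line of zeros of the regular solution: the graph of `E ↦ r_n(ℓ, E)`, that is, the
set of the pairs `(E, r)` such that `r` is the `n`-th zero of the regular solution at energy `E`. -/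
def lineOfZeros (V : ℝ → ℝ) (ℓ : ℝ) (n : ℕ) : Set (ℝ × ℝ) :=
  {p | ∃ ψ : ℝ → ℝ, IsRegularSolution V ℓ p.1 ψ ∧ IsNthZero ψ n p.2}

/-- The line of zeros describes the whole positive `r`-axis as the energy varies. -/
def SweepsPositiveAxis (L : Set (ℝ × ℝ)) : Prop :=
  Prod.snd '' L = Ioi 0

end FixedEll

/-! Let `E r` be the energy at which the common line reaches `r`, and let `φ₁`, `φ₂` be the two
regular solutions at that energy, scaled to have slope `-1` at their common zero `r`. The potentials
are compared outwards from the origin.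

Near the origin both potentials are constants `c₁`, `c₂`. Rescaling `r` preserves the centrifugal
term, so along a line of zeros `(E r - cᵢ) r²` is constant (`IsLineFamily.scaling`); two radii then
give `c₁ = c₂`.

Suppose `V₁ = V₂` a.e. on `(0, R)`. For `r > R` the Wronskian of `φ₁`, `φ₂` vanishes at `R`, since
both are multiples of regular solutions of one equation there, and at `r`, since both vanish.
Lagrange's identity gives `∫_R^r (V₂ - V₁) φ₁ φ₂ = 0` for every `r` slightly above `R`. The product
`φ₁ φ₂` has a double zero at `x = r`, so two integrations by parts turn this into `∫_R^r w (φ₁ φ₂)''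
= 0`, where `w` is the double primitive of `V₂ - V₁`. This is a Volterra equation of the first kind
whose kernel is, up to a term with small integral, close to `2` on the diagonal, so `w = 0` near `R`
(`eq_zero_of_integral_eq_zero`) and the potentials agree a little further. A supremum argument
(`ae_Ioi_of_extend`) then covers the half-line.

The Volterra step needs the kernel, hence `E`, to be Lipschitz in `r`. Sturm comparison shows that
`E` decreases strictly (`energy_lt`), and a quantitative Wronskian estimate bounds its slope
(`energy_sub_le`). The comparison starts at the singular origin, where `wr_not_le_neg` replaces a
boundary value of the Wronskian and `ℓ ≥ -1/2` is essential. -/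

namespace FixedEll

/-! ### Carathéodory solutions and Lagrange's identity for the Wronskian. -/

section

/-- The fundamental theorem of calculus for an absolutely continuous function with a prescribed
almost everywhere derivative. -/
lemma ac_ftc {f g : ℝ → ℝ} {a b : ℝ} (hf : AbsolutelyContinuousOnInterval f a b)
    (hd : ∀ᵐ x, x ∈ uIcc a b → HasDerivAt f (g x) x) :
    IntervalIntegrable g volume a b ∧ ∫ x in a..b, g x = f b - f a := by
  have h : ∀ᵐ x, x ∈ uIoc a b → deriv f x = g x := by
    filter_upwards [hd] with x hx hx'
    exact (hx (uIoc_subset_uIcc hx')).deriv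
  refine ⟨hf.intervalIntegrable_deriv.congr_ae ?_, ?_⟩
  · exact (ae_restrict_iff' measurableSet_uIoc).2 h
  · rw [← hf.integral_deriv_eq_sub]
    refine intervalIntegral.integral_congr_ae ?_
    filter_upwards [h] with x hx hx'
    exact (hx hx').symm

/-- A differentiable function with absolutely continuous derivative is absolutely continuous. -/
lemma ac_of_ac_deriv {y : ℝ → ℝ} {s t : ℝ} (hd : ∀ x ∈ uIcc s t, DifferentiableAt ℝ y x)
    (hac : AbsolutelyContinuousOnInterval (deriv y) s t) :
    AbsolutelyContinuousOnInterval y s t := by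
  obtain ⟨C, hC⟩ := hac.exists_bound
  have hC0 : 0 ≤ C := (norm_nonneg _).trans (hC s left_mem_uIcc)
  refine LipschitzOnWith.absolutelyContinuousOnInterval (K := ⟨C, hC0⟩) ?_
  refine Convex.lipschitzOnWith_of_nnnorm_deriv_le hd (fun x hx => ?_) (convex_uIcc s t)
  exact hC x hx

/-- `y` solves `y'' = Q y` on `(0, b)` in the sense of Carathéodory. -/
structure IsSol (Q y : ℝ → ℝ) (b : ℝ) : Prop where
  diff : ∀ x ∈ Ioo 0 b, DifferentiableAt ℝ y x
  ac : ∀ s t : ℝ, 0 < s → s ≤ t → t < b → AbsolutelyContinuousOnInterval (deriv y) s t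
  eqn : ∀ᵐ x, x ∈ Ioo 0 b → HasDerivAt (deriv y) (Q x * y x) x

/-- The Wronskian of two functions. -/
noncomputable def wr (u v : ℝ → ℝ) (x : ℝ) : ℝ := u x * deriv v x - deriv u x * v x

lemma wr_comm (u v : ℝ → ℝ) (x : ℝ) : wr v u x = - wr u v x := by
  unfold wr; ring

namespace IsSol

variable {Q Q₁ Q₂ u v y : ℝ → ℝ} {b : ℝ}

lemma const_mul (h : IsSol Q y b) (k : ℝ) : IsSol Q (fun x => k * y x) b where
  diff x hx := (h.diff x hx).const_mul k
  ac s t hs hst ht := by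
    have : deriv (fun x => k * y x) = fun x => k * deriv y x := by
      funext x; exact deriv_const_mul_field k
    rw [this]
    exact (h.ac s t hs hst ht).const_mul k
  eqn := by
    have : deriv (fun x => k * y x) = fun x => k * deriv y x := by
      funext x; exact deriv_const_mul_field k
    rw [this]
    filter_upwards [h.eqn] with x hx hx'
    have := (hx hx').const_mul k
    rwa [mul_left_comm] at this

lemma continuousAt (h : IsSol Q y b) {x : ℝ} (hx : x ∈ Ioo 0 b) : ContinuousAt y x :=
  (h.diff x hx).continuousAt

lemma continuousOn (h : IsSol Q y b) : ContinuousOn y (Ioo 0 b) :=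
  fun _ hx => (h.continuousAt hx).continuousWithinAt

lemma hasDerivAt (h : IsSol Q y b) {x : ℝ} (hx : x ∈ Ioo 0 b) : HasDerivAt y (deriv y x) x :=
  (h.diff x hx).hasDerivAt

lemma ac_self (h : IsSol Q y b) {s t : ℝ} (hs : 0 < s) (hst : s ≤ t) (ht : t < b) :
    AbsolutelyContinuousOnInterval y s t := by
  refine ac_of_ac_deriv (fun x hx => h.diff x ?_) (h.ac s t hs hst ht)
  rw [uIcc_of_le hst] at hx
  exact ⟨hs.trans_le hx.1, hx.2.trans_lt ht⟩

/-- Lagrange's identity: on differentiating the Wronskian the terms `u' v'` cancel. It serves both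
for two energies, where `Q₂ - Q₁` is constant, and for two potentials at one energy. -/
lemma wr_ftc (hu : IsSol Q₁ u b) (hv : IsSol Q₂ v b) {s t : ℝ} (hs : 0 < s) (hst : s ≤ t)
    (ht : t < b) :
    IntervalIntegrable (fun x => (Q₂ x - Q₁ x) * (u x * v x)) volume s t ∧
      ∫ x in s..t, (Q₂ x - Q₁ x) * (u x * v x) = wr u v t - wr u v s := by
  refine ac_ftc (f := wr u v) (((hu.ac_self hs hst ht).mul (hv.ac s t hs hst ht)).sub
    ((hu.ac s t hs hst ht).mul (hv.ac_self hs hst ht))) ?_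
  filter_upwards [hu.eqn, hv.eqn] with x hx hx' hxm
  rw [uIcc_of_le hst] at hxm
  have hm : x ∈ Ioo 0 b := ⟨hs.trans_le hxm.1, hxm.2.trans_lt ht⟩
  have := ((hu.hasDerivAt hm).mul (hx' hm)).sub ((hx hm).mul (hv.hasDerivAt hm))
  refine this.congr_deriv ?_
  ring

lemma wr_ftc_const (hu : IsSol Q₁ u b) (hv : IsSol Q₂ v b) {κ : ℝ}
    (hQ : ∀ᵐ x, x ∈ Ioo 0 b → Q₂ x - Q₁ x = κ) {s t : ℝ} (hs : 0 < s) (hst : s ≤ t)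
    (ht : t < b) :
    wr u v t - wr u v s = κ * ∫ x in s..t, u x * v x := by
  rw [← (hu.wr_ftc hv hs hst ht).2, ← intervalIntegral.integral_const_mul]
  refine intervalIntegral.integral_congr_ae ?_
  filter_upwards [hQ] with x hx hx'
  rw [uIoc_of_le hst] at hx'
  rw [hx ⟨hs.trans hx'.1, hx'.2.trans_lt ht⟩]

lemma intervalIntegrable_mul (hu : IsSol Q₁ u b) (hv : IsSol Q₂ v b) {s t : ℝ} (hs : 0 < s)
    (hst : s ≤ t) (ht : t < b) : IntervalIntegrable (fun x => u x * v x) volume s t :=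
  ((hu.ac_self hs hst ht).continuousOn.mul (hv.ac_self hs hst ht).continuousOn).intervalIntegrable

end IsSol

lemma IsRadialSolution.isSol {V ψ : ℝ → ℝ} {ℓ E : ℝ} (h : IsRadialSolution V ℓ E ψ) (b : ℝ) :
    IsSol (fun r => V r + ((ℓ + 1 / 2) ^ 2 - 1 / 4) / r ^ 2 - E) ψ b where
  diff x hx := h.differentiableAt x hx.1
  ac s t hs hst _ := h.absolutelyContinuous s t hs hst
  eqn := by
    filter_upwards [(ae_restrict_iff' measurableSet_Ioi).1 h.equation] with x hx hx'
    convert! hx hx'.1 using 2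
    ring

end

/-! ### Sturm comparison from the singular endpoint. -/

section

lemma wr_const_mul (u v : ℝ → ℝ) (k m x : ℝ) :
    wr (fun x => k * u x) (fun x => m * v x) x = k * m * wr u v x := by
  unfold wr
  rw [deriv_const_mul_field, deriv_const_mul_field]
  ring

/-- The normalization `u(r) ~ r^(ℓ+1)` at the origin. -/
def RegularAtZero (ℓ : ℝ) (u : ℝ → ℝ) : Prop :=
  Tendsto (fun r : ℝ => u r * r ^ (-ℓ - 1)) (𝓝[>] 0) (𝓝 1)

/-- Since `ℓ + 1 ≥ 1/2`, a regular solution is at most `2 √r` near the origin. Hence `1 / u²` is not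
integrable at `0`, which is what drives `wr_not_le_neg`. -/
lemma RegularAtZero.exists_pos {ℓ : ℝ} (hℓ : -1 / 2 ≤ ℓ) {u : ℝ → ℝ} (hu : RegularAtZero ℓ u) :
    ∃ ε, 0 < ε ∧ ∀ r ∈ Ioo 0 ε, 0 < u r ∧ u r ^ 2 ≤ 4 * r := by
  have h := hu (Ioo_mem_nhds (show (0 : ℝ) < 1 by norm_num) (show (1 : ℝ) < 2 by norm_num))
  obtain ⟨ε, hε, hs⟩ := mem_nhdsGT_iff_exists_Ioo_subset.1 h
  refine ⟨min ε 1, lt_min hε one_pos, fun r hr => ?_⟩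
  have hr0 : 0 < r := hr.1
  have hr1 : r ≤ 1 := (hr.2.trans_le (min_le_right _ _)).le
  have hm := hs ⟨hr0, hr.2.trans_le (min_le_left _ _)⟩
  simp only [mem_preimage, mem_Ioo] at hm
  have hp : 0 < r ^ (-ℓ - 1) := Real.rpow_pos_of_pos hr0 _
  have hpos : 0 < u r := pos_of_mul_pos_left hm.1 hp.le
  refine ⟨hpos, ?_⟩
  have he : u r = (u r * r ^ (-ℓ - 1)) * r ^ (ℓ + 1) := by
    rw [mul_assoc, ← Real.rpow_add hr0]
    simp
  have hq : r ^ (ℓ + 1) ≤ r ^ (1 / 2 : ℝ) :=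
    Real.rpow_le_rpow_of_exponent_ge hr0 hr1 (by linarith)
  have hq' : (r ^ (1 / 2 : ℝ)) ^ 2 = r := by
    rw [← Real.sqrt_eq_rpow]; exact Real.sq_sqrt hr0.le
  have h2 : u r ≤ 2 * r ^ (1 / 2 : ℝ) := by
    rw [he]
    exact mul_le_mul hm.2.le hq (Real.rpow_nonneg hr0.le _) (by norm_num)
  calc u r ^ 2 ≤ (2 * r ^ (1 / 2 : ℝ)) ^ 2 := pow_le_pow_left₀ hpos.le h2 2
    _ = 4 * r := by rw [mul_pow, hq']; norm_num

variable {Q Q₁ Q₂ u v : ℝ → ℝ} {b ℓ : ℝ}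

/-- The Wronskian of two functions with the same leading behaviour at the origin cannot stay
below a negative constant near the origin. -/
lemma wr_not_le_neg (hℓ : -1 / 2 ≤ ℓ) (hu : IsSol Q₁ u b) (hv : IsSol Q₂ v b)
    (cu : RegularAtZero ℓ u) (cv : RegularAtZero ℓ v) {x c : ℝ} (hx : 0 < x) (hxb : x ≤ b)
    (hc : 0 < c) (h : ∀ t ∈ Ioo 0 x, wr u v t ≤ -c) : False := by
  obtain ⟨ε, hε, hpos⟩ := cu.exists_pos hℓ
  set δ := min ε x with hδ
  have hδ0 : 0 < δ := lt_min hε hx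
  -- As `(v / u)' = wr u v / u² ≤ -c / (4 r)`, the sum `v / u + (c / 4) log r` is nonincreasing. But
  -- `v / u → 1`, so the sum tends to `-∞` at `0⁺`, which is impossible. No asymptotics of `u'` or
  -- `v'` are needed.
  have hd : ∀ r ∈ Ioo 0 δ, HasDerivAt (fun r => v r / u r + c / 4 * Real.log r)
      ((deriv v r * u r - v r * deriv u r) / u r ^ 2 + c / 4 * r⁻¹) r := by
    intro r hr
    have hrb : r ∈ Ioo 0 b := ⟨hr.1, (hr.2.trans_le (min_le_right _ _)).trans_le hxb⟩
    have hne : u r ≠ 0 := (hpos r ⟨hr.1, hr.2.trans_le (min_le_left _ _)⟩).1.ne'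
    exact ((hv.hasDerivAt hrb).div (hu.hasDerivAt hrb) hne).add
      ((Real.hasDerivAt_log hr.1.ne').const_mul _)
  have hanti : AntitoneOn (fun r => v r / u r + c / 4 * Real.log r) (Ioo 0 δ) := by
    refine antitoneOn_of_deriv_nonpos (convex_Ioo _ _)
      (fun r hr => (hd r hr).continuousAt.continuousWithinAt) ?_ ?_
    · rw [interior_Ioo]
      exact fun r hr => (hd r hr).differentiableAt.differentiableWithinAt
    · rw [interior_Ioo]
      intro r hr
      rw [(hd r hr).deriv]
      obtain ⟨hu0, hu2⟩ := hpos r ⟨hr.1, hr.2.trans_le (min_le_left _ _)⟩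
      have hw := h r ⟨hr.1, hr.2.trans_le (min_le_right _ _)⟩
      have h1 : (deriv v r * u r - v r * deriv u r) / u r ^ 2 ≤ -c / u r ^ 2 := by
        refine div_le_div_of_nonneg_right ?_ (sq_nonneg _)
        unfold wr at hw
        linarith
      have h2 : c / 4 * r⁻¹ ≤ c / u r ^ 2 := by
        have : c / 4 * r⁻¹ = c / (4 * r) := by field_simp
        rw [this]
        exact div_le_div_of_nonneg_left hc.le (pow_pos hu0 2) hu2
      have h3 : -c / u r ^ 2 = -(c / u r ^ 2) := neg_div _ _
      linarith
  have hlim : Tendsto (fun r => v r / u r) (𝓝[>] 0) (𝓝 1) := by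
    have := Tendsto.div cv cu one_ne_zero
    rw [div_one] at this
    refine this.congr' ?_
    filter_upwards [self_mem_nhdsWithin] with r hr
    have hp : r ^ (-ℓ - 1) ≠ 0 := (Real.rpow_pos_of_pos hr _).ne'
    exact mul_div_mul_right _ _ hp
  have hbot : Tendsto (fun r => v r / u r + c / 4 * Real.log r) (𝓝[>] 0) atBot :=
    hlim.add_atBot (Real.tendsto_log_nhdsGT_zero.const_mul_atBot (by positivity))
  have hev := hbot.eventually_lt_atBot (v (δ / 2) / u (δ / 2) + c / 4 * Real.log (δ / 2))
  obtain ⟨r, hr1, hr2⟩ := (hev.and (Ioo_mem_nhdsGT (half_pos hδ0))).exists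
  have := hanti ⟨hr2.1, by linarith [hr2.2]⟩ ⟨half_pos hδ0, half_lt_self hδ0⟩ hr2.2.le
  simp only at this
  linarith

/-- Two regular solutions of the same equation have vanishing Wronskian. -/
lemma wr_eq_zero (hℓ : -1 / 2 ≤ ℓ) (hu : IsSol Q₁ u b) (hv : IsSol Q₂ v b)
    (cu : RegularAtZero ℓ u) (cv : RegularAtZero ℓ v)
    (hQ : ∀ᵐ x, x ∈ Ioo 0 b → Q₂ x - Q₁ x = 0) {x : ℝ} (hx : x ∈ Ioo 0 b) : wr u v x = 0 := by
  have hconst : ∀ t ∈ Ioo 0 x, wr u v t = wr u v x := by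
    intro t ht
    have := hu.wr_ftc_const hv hQ ht.1 ht.2.le hx.2
    linarith
  -- The Wronskian is constant, and a nonzero constant is negative for one of the two orders of `u`
  -- and `v`.
  rcases lt_trichotomy (wr u v x) 0 with h | h | h
  · exact (wr_not_le_neg hℓ hu hv cu cv hx.1 hx.2.le (neg_pos.2 h)
      (fun t ht => by rw [hconst t ht, neg_neg])).elim
  · exact h
  · refine (wr_not_le_neg hℓ hv hu cv cu hx.1 hx.2.le h (fun t ht => ?_)).elim
    rw [wr_comm, hconst t ht]

/-- A nonvanishing continuous function on an open interval has constant sign. -/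
lemma exists_sign {f : ℝ → ℝ} {p x : ℝ} (hf : ContinuousOn f (Ioo p x))
    (h0 : ∀ t ∈ Ioo p x, f t ≠ 0) :
    ∃ σ : ℝ, (σ = 1 ∨ σ = -1) ∧ ∀ t ∈ Ioo p x, 0 < σ * f t := by
  by_cases h : ∀ t ∈ Ioo p x, 0 < f t
  · exact ⟨1, Or.inl rfl, fun t ht => by simpa using h t ht⟩
  · push Not at h
    obtain ⟨t₀, ht₀, hneg⟩ := h
    refine ⟨-1, Or.inr rfl, fun t ht => ?_⟩
    by_contra hcon
    have hpos : 0 ≤ f t := by linarith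
    obtain ⟨s, hs, hs0⟩ := (isPreconnected_Ioo.intermediate_value ht₀ ht hf) ⟨hneg, hpos⟩
    exact h0 s hs hs0

lemma deriv_nonneg_of_pos_right {f : ℝ → ℝ} {p x : ℝ} (hpx : p < x) (hf : DifferentiableAt ℝ f p)
    (h0 : f p = 0) (h : ∀ t ∈ Ioo p x, 0 < f t) : 0 ≤ deriv f p := by
  have ht : Tendsto (slope f p) (𝓝[>] p) (𝓝 (deriv f p)) :=
    (hasDerivAt_iff_tendsto_slope.1 hf.hasDerivAt).mono_left
      (nhdsWithin_mono _ fun t ht => ne_of_gt ht)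
  refine ge_of_tendsto ht ?_
  filter_upwards [Ioo_mem_nhdsGT hpx] with t htm
  rw [slope_def_field, h0, sub_zero]
  exact div_nonneg (h t htm).le (by linarith [htm.1])

lemma deriv_nonpos_of_pos_left {f : ℝ → ℝ} {p x : ℝ} (hpx : p < x) (hf : DifferentiableAt ℝ f x)
    (h0 : f x = 0) (h : ∀ t ∈ Ioo p x, 0 < f t) : deriv f x ≤ 0 := by
  have ht : Tendsto (slope f x) (𝓝[<] x) (𝓝 (deriv f x)) :=
    (hasDerivAt_iff_tendsto_slope.1 hf.hasDerivAt).mono_left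
      (nhdsWithin_mono _ fun t ht => ne_of_lt ht)
  refine le_of_tendsto ht ?_
  filter_upwards [Ioo_mem_nhdsLT hpx] with t htm
  rw [slope_def_field, h0, sub_zero]
  exact div_nonpos_of_nonneg_of_nonpos (h t htm).le (by linarith [htm.2])

lemma nonneg_of_pos_right {f : ℝ → ℝ} {p x : ℝ} (hpx : p < x) (hf : ContinuousAt f p)
    (h : ∀ t ∈ Ioo p x, 0 < f t) : 0 ≤ f p := by
  refine ge_of_tendsto (hf.tendsto.mono_left nhdsWithin_le_nhds : Tendsto f (𝓝[>] p) _) ?_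
  filter_upwards [Ioo_mem_nhdsGT hpx] with t htm using (h t htm).le

lemma nonneg_of_pos_left {f : ℝ → ℝ} {p x : ℝ} (hpx : p < x) (hf : ContinuousAt f x)
    (h : ∀ t ∈ Ioo p x, 0 < f t) : 0 ≤ f x := by
  refine ge_of_tendsto (hf.tendsto.mono_left nhdsWithin_le_nhds : Tendsto f (𝓝[<] x) _) ?_
  filter_upwards [Ioo_mem_nhdsLT hpx] with t htm using (h t htm).le

lemma IsSol.wr_mono (hu : IsSol Q₁ u b) (hv : IsSol Q₂ v b) {κ : ℝ} (hκ : 0 ≤ κ)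
    (hQ : ∀ᵐ x, x ∈ Ioo 0 b → Q₂ x - Q₁ x = κ) {s t : ℝ} (hs : 0 < s) (hst : s ≤ t)
    (ht : t < b) (hpos : ∀ r ∈ Ioo s t, 0 ≤ u r * v r) : wr u v s ≤ wr u v t := by
  have h := hu.wr_ftc_const hv hQ hs hst ht
  have h2 : 0 ≤ ∫ x in s..t, u x * v x := by
    rw [intervalIntegral.integral_of_le hst, integral_Ioc_eq_integral_Ioo]
    exact setIntegral_nonneg measurableSet_Ioo hpos
  nlinarith [mul_nonneg hκ h2]

lemma IsSol.wr_strictMono (hu : IsSol Q₁ u b) (hv : IsSol Q₂ v b) {κ : ℝ} (hκ : 0 < κ)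
    (hQ : ∀ᵐ x, x ∈ Ioo 0 b → Q₂ x - Q₁ x = κ) {s t : ℝ} (hs : 0 < s) (hst : s < t)
    (ht : t < b) (hpos : ∀ r ∈ Ioo s t, 0 < u r * v r) : wr u v s < wr u v t := by
  have h := hu.wr_ftc_const hv hQ hs hst.le ht
  have h2 : 0 < ∫ x in s..t, u x * v x :=
    intervalIntegral.intervalIntegral_pos_of_pos_on (hu.intervalIntegrable_mul hv hs hst.le ht)
      hpos hst
  nlinarith [mul_pos hκ h2]

/-- Beyond a zero `p` of `v` (or the origin), as long as neither function vanishes, the Wronskian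
has the sign of `u v` provided `u` has the larger energy. -/
lemma wr_mul_nonneg (hℓ : -1 / 2 ≤ ℓ) (hu : IsSol Q₁ u b) (hv : IsSol Q₂ v b)
    (cu : RegularAtZero ℓ u) (cv : RegularAtZero ℓ v) {κ : ℝ} (hκ : 0 ≤ κ)
    (hQ : ∀ᵐ x, x ∈ Ioo 0 b → Q₂ x - Q₁ x = κ) {p x : ℝ} (hp : p = 0 ∨ 0 < p ∧ v p = 0)
    (hxb : x ≤ b) (hu0 : ∀ t ∈ Ioo p x, u t ≠ 0) (hv0 : ∀ t ∈ Ioo p x, v t ≠ 0)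
    {t : ℝ} (ht : t ∈ Ioo p x) : 0 ≤ wr u v t * (u t * v t) := by
  have hp0 : 0 ≤ p := by rcases hp with h | h <;> linarith [h]
  have hsub : Ioo p x ⊆ Ioo 0 b := Ioo_subset_Ioo hp0 hxb
  obtain ⟨σ, hσ, hσp⟩ := exists_sign (hu.continuousOn.mono hsub) hu0
  obtain ⟨τ, hτ, hτp⟩ := exists_sign (hv.continuousOn.mono hsub) hv0
  have hU := hu.const_mul σ
  have hV := hv.const_mul τ
  have key : 0 ≤ σ * τ * wr u v t := by
    rw [← wr_const_mul]
    have hmono : ∀ s ∈ Ioo p t, wr (fun x => σ * u x) (fun x => τ * v x) s ≤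
        wr (fun x => σ * u x) (fun x => τ * v x) t := by
      intro s hs
      refine hU.wr_mono hV hκ hQ (hp0.trans_lt hs.1) hs.2.le (hsub ht).2 (fun r hr => ?_)
      have hr' : r ∈ Ioo p x := ⟨hs.1.trans hr.1, hr.2.trans ht.2⟩
      exact (mul_pos (hσp r hr') (hτp r hr')).le
    -- At the origin the normalization forces both signs to be `+1`, and a negative value at `t`
    -- would persist down to `0` by monotonicity. At a zero `p` of `v` the Wronskian reduces to `u
    -- v'`, whose sign is known.
    rcases hp with rfl | ⟨hp, hvp⟩
    · obtain ⟨ε, hε, hεp⟩ := cu.exists_pos hℓ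
      obtain ⟨ε', hε', hεp'⟩ := cv.exists_pos hℓ
      have hm : 0 < min (min ε ε') x := lt_min (lt_min hε hε') (ht.1.trans ht.2)
      set m := min (min ε ε') x / 2 with hmdef
      have hm0 : 0 < m := half_pos hm
      have hlt : m < min (min ε ε') x := half_lt_self hm
      have hmx : m ∈ Ioo 0 x := ⟨hm0, hlt.trans_le (min_le_right _ _)⟩
      have h1 := (hεp m ⟨hm0, hlt.trans_le ((min_le_left _ _).trans (min_le_left _ _))⟩).1
      have h2 := (hεp' m ⟨hm0, hlt.trans_le ((min_le_left _ _).trans (min_le_right _ _))⟩).1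
      have hσ1 : σ = 1 := by
        rcases hσ with h | h
        · exact h
        · have := hσp m hmx
          rw [h] at this
          linarith
      have hτ1 : τ = 1 := by
        rcases hτ with h | h
        · exact h
        · have := hτp m hmx
          rw [h] at this
          linarith
      subst hσ1 hτ1
      simp only [one_mul] at hmono ⊢
      by_contra hcon
      push Not at hcon
      refine wr_not_le_neg hℓ hu hv cu cv ht.1 (hsub ht).2.le (neg_pos.2 hcon) (fun s hs => ?_)
      rw [neg_neg]
      exact hmono s hs
    · have hpx : p < x := ht.1.trans ht.2
      have hpb : p ∈ Ioo 0 b := ⟨hp, hpx.trans_le hxb⟩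
      have h1 : wr (fun x => σ * u x) (fun x => τ * v x) p ≤
          wr (fun x => σ * u x) (fun x => τ * v x) t := by
        refine hU.wr_mono hV hκ hQ hp ht.1.le (hsub ht).2 (fun r hr => ?_)
        have hr' : r ∈ Ioo p x := ⟨hr.1, hr.2.trans ht.2⟩
        exact (mul_pos (hσp r hr') (hτp r hr')).le
      refine le_trans ?_ h1
      have h2 : 0 ≤ σ * u p := nonneg_of_pos_right (f := fun x => σ * u x) hpx (hU.continuousAt hpb) hσp
      have h3 : 0 ≤ deriv (fun x => τ * v x) p :=
        deriv_nonneg_of_pos_right hpx (hV.diff p hpb) (by simp [hvp]) hτp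
      unfold wr
      simp only [hvp, mul_zero, sub_zero]
      exact mul_nonneg h2 h3
  have h4 := mul_pos (hσp t ht) (hτp t ht)
  have h5 : σ * τ * (σ * τ) = 1 := by
    rcases hσ with rfl | rfl <;> rcases hτ with rfl | rfl <;> norm_num
  have h6 := mul_nonneg key h4.le
  calc 0 ≤ _ := h6
    _ = (σ * τ * (σ * τ)) * (wr u v t * (u t * v t)) := by ring
    _ = _ := by rw [h5, one_mul]

/-- Sturm separation: between two successive zeros of `v` (the origin counting as one) there is a
zero of the regular solution `u` of larger energy. -/
lemma exists_zero_between (hℓ : -1 / 2 ≤ ℓ) (hu : IsSol Q₁ u b) (hv : IsSol Q₂ v b)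
    (cu : RegularAtZero ℓ u) (cv : RegularAtZero ℓ v) {κ : ℝ} (hκ : 0 < κ)
    (hQ : ∀ᵐ x, x ∈ Ioo 0 b → Q₂ x - Q₁ x = κ) {p z : ℝ} (hp : p = 0 ∨ 0 < p ∧ v p = 0)
    (hpz : p < z) (hzb : z < b) (hz : v z = 0) (hv0 : ∀ t ∈ Ioo p z, v t ≠ 0) :
    ∃ y ∈ Ioo p z, u y = 0 := by
  by_contra! hu0
  have hp0 : 0 ≤ p := by rcases hp with h | h <;> linarith [h]
  have hsub : Ioo p z ⊆ Ioo 0 b := Ioo_subset_Ioo hp0 hzb.le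
  have hzm : z ∈ Ioo 0 b := ⟨hp0.trans_lt hpz, hzb⟩
  obtain ⟨σ, hσ, hσp⟩ := exists_sign (hu.continuousOn.mono hsub) hu0
  obtain ⟨τ, hτ, hτp⟩ := exists_sign (hv.continuousOn.mono hsub) hv0
  have hU := hu.const_mul σ
  have hV := hv.const_mul τ
  -- An interior starting point is used because `p` may be the origin, where the Wronskian is not
  -- controlled directly.
  have hm : (p + z) / 2 ∈ Ioo p z := ⟨by linarith, by linarith⟩
  have h1 : 0 ≤ σ * τ * wr u v ((p + z) / 2) := by
    have h2 := wr_mul_nonneg hℓ hu hv cu cv hκ.le hQ hp hzb.le hu0 hv0 hm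
    have h4 := mul_pos (hσp _ hm) (hτp _ hm)
    by_contra hcon
    push Not at hcon
    have h5 : σ * τ * (σ * τ) = 1 := by
      rcases hσ with rfl | rfl <;> rcases hτ with rfl | rfl <;> norm_num
    have h6 := mul_neg_of_neg_of_pos hcon h4
    have h7 : σ * τ * wr u v ((p + z) / 2) * (σ * u ((p + z) / 2) * (τ * v ((p + z) / 2))) =
      (σ * τ * (σ * τ)) * (wr u v ((p + z) / 2) * (u ((p + z) / 2) * v ((p + z) / 2))) := by ring
    rw [h7, h5, one_mul] at h6
    linarith
  rw [← wr_const_mul] at h1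
  -- The signed Wronskian is nonnegative at the midpoint and strictly increases up to `z`, yet at
  -- `z` it equals `u v'` with signs `≥ 0` and `≤ 0`.
  have h2 := hU.wr_strictMono hV hκ hQ (hp0.trans_lt hm.1) hm.2 hzb (fun r hr =>
    mul_pos (hσp r ⟨hm.1.trans hr.1, hr.2⟩) (hτp r ⟨hm.1.trans hr.1, hr.2⟩))
  have h3 : 0 ≤ σ * u z := nonneg_of_pos_left (f := fun x => σ * u x) hpz (hU.continuousAt hzm) hσp
  have h4 : deriv (fun x => τ * v x) z ≤ 0 :=
    deriv_nonpos_of_pos_left hpz (hV.diff z hzm) (by simp [hz]) hτp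
  have h5 : wr (fun x => σ * u x) (fun x => τ * v x) z ≤ 0 := by
    unfold wr
    simp only [hz, mul_zero, sub_zero]
    exact mul_nonpos_of_nonneg_of_nonpos h3 h4
  linarith

/-- The zeros of `v` in `(0, x]`. -/
def zerosUpTo (v : ℝ → ℝ) (x : ℝ) : Set ℝ := {s | 0 < s ∧ s ≤ x ∧ v s = 0}

/-- If `v` has finitely many zeros in `(0, z]`, there is a last one before `z`, unless there is
none, in which case the origin takes its place. -/
lemma exists_previous_zero {z : ℝ} (hz : 0 < z) (hfin : (zerosUpTo v z).Finite) :
    ∃ p, (p = 0 ∨ 0 < p ∧ v p = 0) ∧ p < z ∧ ∀ t ∈ Ioo p z, v t ≠ 0 := by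
  have hfin' : {s | s ∈ zerosUpTo v z ∧ s < z}.Finite := hfin.subset (fun s hs => hs.1)
  rcases {s | s ∈ zerosUpTo v z ∧ s < z}.eq_empty_or_nonempty with h | h
  · refine ⟨0, Or.inl rfl, hz, fun t ht ht0 => ?_⟩
    have : t ∈ {s | s ∈ zerosUpTo v z ∧ s < z} := ⟨⟨ht.1, ht.2.le, ht0⟩, ht.2⟩
    rw [h] at this
    exact this
  · obtain ⟨p, hp, hmax⟩ := hfin'.exists_maximalFor id _ h
    refine ⟨p, Or.inr ⟨hp.1.1, hp.1.2.2⟩, hp.2, fun t ht ht0 => ?_⟩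
    have := hmax (j := t) ⟨⟨hp.1.1.trans ht.1, ht.2.le, ht0⟩, ht.2⟩ ht.1.le
    exact absurd ht.1 (not_lt.2 this)

/-- Raising the energy does not decrease the number of zeros, and pushes them to the left. -/
lemma encard_zeros_le (hℓ : -1 / 2 ≤ ℓ) (hu : IsSol Q₁ u b) (hv : IsSol Q₂ v b)
    (cu : RegularAtZero ℓ u) (cv : RegularAtZero ℓ v) {κ : ℝ} (hκ : 0 < κ)
    (hQ : ∀ᵐ x, x ∈ Ioo 0 b → Q₂ x - Q₁ x = κ) {x : ℝ} (hxb : x < b)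
    (hfin : (zerosUpTo v x).Finite) :
    (zerosUpTo v x).encard ≤ {s | 0 < s ∧ s < x ∧ u s = 0}.encard := by
  -- Each zero of `v` is sent to a zero of `u` lying strictly between it and its predecessor; the
  -- last clause makes this map injective.
  have hex : ∀ z ∈ zerosUpTo v x, ∃ y, (0 < y ∧ y < z ∧ u y = 0) ∧
      ∀ z' ∈ zerosUpTo v x, z' < z → z' < y := by
    intro z hz
    have hfz : (zerosUpTo v z).Finite :=
      hfin.subset (fun s hs => ⟨hs.1, hs.2.1.trans hz.2.1, hs.2.2⟩)
    obtain ⟨p, hp, hpz, hv0⟩ := exists_previous_zero hz.1 hfz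
    obtain ⟨y, hy, hy0⟩ := exists_zero_between hℓ hu hv cu cv hκ hQ hp hpz
      (hz.2.1.trans_lt hxb) hz.2.2 hv0
    have hp0 : 0 ≤ p := by rcases hp with h | h <;> linarith [h]
    refine ⟨y, ⟨hp0.trans_lt hy.1, hy.2, hy0⟩, fun z' hz' hlt => ?_⟩
    by_contra hcon
    push Not at hcon
    exact hv0 z' ⟨hy.1.trans_le hcon, hlt⟩ hz'.2.2
  choose! f hf hf' using hex
  refine encard_le_encard_of_injOn (f := f) (fun z hz => ?_) (fun z hz z' hz' heq => ?_)
  · exact ⟨(hf z hz).1, (hf z hz).2.1.trans_le hz.2.1, (hf z hz).2.2⟩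
  · rcases lt_trichotomy z z' with h | h | h
    · have h1 := hf' z' hz' z hz h
      have h2 := (hf z hz).2.1
      linarith
    · exact h
    · have h1 := hf' z hz z' hz' h
      have h2 := (hf z' hz').2.1
      linarith

end

/-! ### A priori bounds on short intervals and simplicity of zeros. -/

section

lemma intervalIntegral_le_of_subinterval {f : ℝ → ℝ} {a b c d : ℝ}
    (hf : IntervalIntegrable f volume a b) (h0 : ∀ x, 0 ≤ f x) (hac : a ≤ c) (hcd : c ≤ d)
    (hdb : d ≤ b) : ∫ x in c..d, f x ≤ ∫ x in a..b, f x :=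
  intervalIntegral.integral_mono_interval hac hcd hdb (Eventually.of_forall h0) hf

lemma intervalIntegrable_of_subinterval {f : ℝ → ℝ} {a b c d : ℝ}
    (hf : IntervalIntegrable f volume a b) (hac : a ≤ c) (hcd : c ≤ d)
    (hdb : d ≤ b) : IntervalIntegrable f volume c d := by
  refine hf.mono_set ?_
  rw [uIcc_of_le hcd, uIcc_of_le (hac.trans (hcd.trans hdb))]
  exact Icc_subset_Icc hac hdb

/-- The increment of a function is bounded by the integral of a bound for its derivative. -/
lemma abs_sub_le_of_ac {f g h : ℝ → ℝ} {a b : ℝ} (hab : a ≤ b)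
    (hf : AbsolutelyContinuousOnInterval f a b)
    (hd : ∀ᵐ x, x ∈ uIcc a b → HasDerivAt f (g x) x)
    (hg : ∀ x ∈ Icc a b, |g x| ≤ h x) (hh : IntervalIntegrable h volume a b) :
    |f b - f a| ≤ ∫ x in a..b, h x := by
  obtain ⟨-, h2⟩ := ac_ftc hf hd
  rw [← h2]
  have := intervalIntegral.norm_integral_le_of_norm_le (f := g) (μ := volume) hab
    (Eventually.of_forall fun x hx => hg x (Ioc_subset_Icc_self hx)) hh
  exact this

/-- A priori bound for `|d''| ≤ P |d| + f` on a short interval, with data at the right end. -/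
lemma growth_bound {d g P f : ℝ → ℝ} {s r D₀ D₁ F : ℝ} (hsr : s ≤ r) (hlen : r - s ≤ 1)
    (hd : ∀ x ∈ Icc s r, DifferentiableAt ℝ d x)
    (hac : AbsolutelyContinuousOnInterval (deriv d) s r)
    (hg : ∀ᵐ x, x ∈ uIcc s r → HasDerivAt (deriv d) (g x) x)
    (hgb : ∀ x ∈ Icc s r, |g x| ≤ P x * |d x| + f x)
    (hP0 : ∀ x, 0 ≤ P x) (hf0 : ∀ x ∈ Icc s r, 0 ≤ f x)
    (hP : IntervalIntegrable P volume s r) (hf : IntervalIntegrable f volume s r)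
    (hPi : ∫ x in s..r, P x ≤ 1 / 4) (hfi : ∫ x in s..r, f x ≤ F)
    (h0 : |d r| ≤ D₀) (h1 : |deriv d r| ≤ D₁) :
    ∀ x ∈ Icc s r, |deriv d x| ≤ 2 * (D₀ + D₁ + F) ∧ |d x| ≤ 3 * (D₀ + D₁ + F) := by
  have hD₀ : 0 ≤ D₀ := (abs_nonneg _).trans h0
  have hD₁ : 0 ≤ D₁ := (abs_nonneg _).trans h1
  have hF : 0 ≤ F := (intervalIntegral.integral_nonneg hsr hf0).trans hfi
  have hcont : ContinuousOn (fun x => |deriv d x|) (Icc s r) := by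
    have := hac.continuousOn
    rw [uIcc_of_le hsr] at this
    exact this.abs
  obtain ⟨z, hz, hmax⟩ := isCompact_Icc.exists_isMaxOn (nonempty_Icc.2 hsr) hcont
  set M := |deriv d z| with hM
  have hM0 : 0 ≤ M := abs_nonneg _
  have hbd : ∀ x ∈ Icc s r, |deriv d x| ≤ M := fun x hx => hmax hx
  have hdb : ∀ x ∈ Icc s r, |d x| ≤ D₀ + M := by
    intro x hx
    have := (convex_Icc s r).norm_image_sub_le_of_norm_deriv_le hd hbd (right_mem_Icc.2 hsr) hx
    have h2 : ‖x - r‖ ≤ 1 := by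
      rw [Real.norm_eq_abs, abs_le]; constructor <;> linarith [hx.1, hx.2]
    have h3 : |d x - d r| ≤ M := this.trans (by nlinarith)
    calc |d x| = |d r + (d x - d r)| := by ring_nf
      _ ≤ |d r| + |d x - d r| := abs_add_le _ _
      _ ≤ _ := add_le_add h0 h3
  have hint : IntervalIntegrable (fun x => P x * (D₀ + M) + f x) volume s r :=
    (hP.mul_const _).add hf
  have hz1 : |deriv d r - deriv d z| ≤ ∫ x in z..r, (P x * (D₀ + M) + f x) := by
    have hsub : uIcc z r ⊆ uIcc s r := by
      rw [uIcc_of_le hz.2, uIcc_of_le hsr]; exact Icc_subset_Icc_left hz.1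
    refine abs_sub_le_of_ac hz.2 (hac.mono hsub) (g := g) ?_ (fun x hx => ?_)
      (intervalIntegrable_of_subinterval hint hz.1 hz.2 le_rfl)
    · filter_upwards [hg] with x hx hx' using hx (hsub hx')
    · have hx' : x ∈ Icc s r := ⟨hz.1.trans hx.1, hx.2⟩
      refine (hgb x hx').trans ?_
      have := mul_le_mul_of_nonneg_left (hdb x hx') (hP0 x)
      linarith
  have hz2 : ∫ x in z..r, (P x * (D₀ + M) + f x) ≤ ∫ x in s..r, (P x * (D₀ + M) + f x) := by
    refine intervalIntegral.integral_mono_interval hz.1 hz.2 le_rfl ?_ hint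
    refine (ae_restrict_iff' measurableSet_Ioc).2 (Eventually.of_forall fun x hx => ?_)
    have h4 := hf0 x (Ioc_subset_Icc_self hx)
    have h5 := mul_nonneg (hP0 x) (add_nonneg hD₀ hM0)
    simp only [Pi.zero_apply]
    linarith
  have hz3 : ∫ x in s..r, (P x * (D₀ + M) + f x) ≤ 1 / 4 * (D₀ + M) + F := by
    rw [intervalIntegral.integral_add (hP.mul_const _) hf, intervalIntegral.integral_mul_const]
    have := mul_le_mul_of_nonneg_right hPi (add_nonneg hD₀ hM0)
    linarith
  have hM2 : M ≤ 2 * (D₀ + D₁ + F) := by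
    have : M ≤ |deriv d r| + |deriv d r - deriv d z| := by
      have := abs_sub_abs_le_abs_sub (deriv d z) (deriv d r)
      rw [abs_sub_comm] at this
      linarith
    linarith
  have hM3 : D₀ + M ≤ 3 * (D₀ + D₁ + F) := by
    have : M ≤ |deriv d r| + |deriv d r - deriv d z| := by
      have := abs_sub_abs_le_abs_sub (deriv d z) (deriv d r)
      rw [abs_sub_comm] at this
      linarith
    linarith
  exact fun x hx => ⟨(hbd x hx).trans hM2, (hdb x hx).trans hM3⟩

/-- A short interval on which the nonnegative function `G` has small integral. -/
structure SmallInterval (G : ℝ → ℝ) (α β : ℝ) : Prop where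
  pos : 0 < α
  le : α ≤ β
  length : β - α ≤ 1
  nonneg : ∀ x, 0 ≤ G x
  integrable : IntervalIntegrable G volume α β
  small : ∫ x in α..β, G x ≤ 1 / 4

lemma SmallInterval.sub {G : ℝ → ℝ} {α β γ δ : ℝ} (S : SmallInterval G α β) (h1 : α ≤ γ)
    (h2 : γ ≤ δ) (h3 : δ ≤ β) : SmallInterval G γ δ where
  pos := S.pos.trans_le h1
  le := h2
  length := by linarith [S.length]
  nonneg := S.nonneg
  integrable := intervalIntegrable_of_subinterval S.integrable h1 h2 h3
  small := (intervalIntegral_le_of_subinterval S.integrable S.nonneg h1 h2 h3).trans S.small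

variable {Q y G : ℝ → ℝ} {b α β : ℝ}

lemma IsSol.eqn_on (h : IsSol Q y b) {s t : ℝ} (hs : 0 < s) (hst : s ≤ t) (ht : t < b) :
    ∀ᵐ x, x ∈ uIcc s t → HasDerivAt (deriv y) (Q x * y x) x := by
  filter_upwards [h.eqn] with x hx hx'
  rw [uIcc_of_le hst] at hx'
  exact hx ⟨hs.trans_le hx'.1, hx'.2.trans_lt ht⟩

lemma IsSol.growth (S : SmallInterval G α β) (h : IsSol Q y b) (hβ : β < b)
    (hQ : ∀ x, |Q x| ≤ G x) :
    ∀ x ∈ Icc α β, |deriv y x| ≤ 2 * (|y β| + |deriv y β|) ∧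
      |y x| ≤ 3 * (|y β| + |deriv y β|) := by
  have := growth_bound (d := y) (g := fun x => Q x * y x) (P := G) (f := fun _ => 0) (F := 0)
    S.le S.length (fun x hx => h.diff x ⟨S.pos.trans_le hx.1, hx.2.trans_lt hβ⟩)
    (h.ac _ _ S.pos S.le hβ) (h.eqn_on S.pos S.le hβ) (fun x _ => ?_) S.nonneg
    (fun _ _ => le_rfl) S.integrable intervalIntegrable_const S.small (by simp) le_rfl le_rfl
  · simpa using this
  · rw [abs_mul, add_zero]
    exact mul_le_mul_of_nonneg_right (hQ x) (abs_nonneg _)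

/-- A solution with vanishing Cauchy data vanishes to the left. -/
lemma IsSol.eq_zero (S : SmallInterval G α β) (h : IsSol Q y b) (hβ : β < b)
    (hQ : ∀ x, |Q x| ≤ G x) (h0 : y β = 0) (h1 : deriv y β = 0) : ∀ x ∈ Icc α β, y x = 0 := by
  intro x hx
  have := (h.growth S hβ hQ x hx).2
  rw [h0, h1] at this
  simpa using this

/-- Bounds for the solution with `y(β) = 0`, `y'(β) = -1`. -/
lemma IsSol.unit_bounds (S : SmallInterval G α β) (h : IsSol Q y b) (hβ : β < b)
    (hQ : ∀ x, |Q x| ≤ G x) (h0 : y β = 0) (h1 : deriv y β = -1) :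
    ∀ x ∈ Icc α β, |deriv y x + 1| ≤ 1 / 2 ∧ |deriv y x + 1| ≤ 2 * (β - x) ∧
      (β - x) / 2 ≤ y x ∧ y x ≤ 2 * (β - x) := by
  have hb := h.growth S hβ hQ
  have hdiff : ∀ x ∈ Icc α β, DifferentiableAt ℝ y x :=
    fun x hx => h.diff x ⟨S.pos.trans_le hx.1, hx.2.trans_lt hβ⟩
  rw [h0, h1] at hb
  simp only [abs_zero, abs_neg, abs_one, zero_add, mul_one] at hb
  -- The bounds are bootstrapped: `|y'| ≤ 2` gives `|y| ≤ 2 (β - x)`, and integrating `|y''| ≤ G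
  -- |y|` then brings `y'` close to `-1`.
  have hy2 : ∀ x ∈ Icc α β, |y x| ≤ 2 * (β - x) := by
    intro x hx
    have := (convex_Icc α β).norm_image_sub_le_of_norm_deriv_le hdiff
      (fun x hx => (hb x hx).1) (right_mem_Icc.2 S.le) hx
    rw [h0, sub_zero, Real.norm_eq_abs, Real.norm_eq_abs, abs_sub_comm,
      abs_of_nonneg (show 0 ≤ β - x by linarith [hx.2])] at this
    exact this
  have hd2 : ∀ x ∈ Icc α β, |deriv y x + 1| ≤ (β - x) / 2 := by
    intro x hx
    have hx0 : 0 < x := S.pos.trans_le hx.1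
    have := abs_sub_le_of_ac (h := fun t => G t * (2 * (β - x))) hx.2 (h.ac _ _ hx0 hx.2 hβ)
      (h.eqn_on hx0 hx.2 hβ) (fun t ht => ?_)
      ((intervalIntegrable_of_subinterval S.integrable hx.1 hx.2 le_rfl).mul_const _)
    · rw [h1, intervalIntegral.integral_mul_const] at this
      have h3 := (S.sub hx.1 hx.2 le_rfl).small
      have h4 : |deriv y x + 1| = |-1 - deriv y x| := by rw [← abs_neg]; ring_nf
      rw [h4]
      have h5 := mul_le_mul_of_nonneg_right h3 (show 0 ≤ 2 * (β - x) by linarith [hx.2])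
      linarith
    · rw [abs_mul]
      refine mul_le_mul (hQ t) ((hy2 t ⟨hx.1.trans ht.1, ht.2⟩).trans (by linarith [ht.1]))
        (abs_nonneg _) (S.nonneg t)
  have hhalf : ∀ x ∈ Icc α β, |deriv y x + 1| ≤ 1 / 2 := fun x hx =>
    (hd2 x hx).trans (by linarith [S.length, hx.1])
  intro x hx
  refine ⟨hhalf x hx, (hd2 x hx).trans (by linarith [hx.2]), ?_, (le_abs_self _).trans (hy2 x hx)⟩
  -- The mean value inequality for `y + t`, whose derivative is at most `1/2` in absolute value,
  -- yields the lower bound on `y`.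
  have hder : ∀ x ∈ Icc α β, HasDerivAt (fun t => y t + t) (deriv y x + 1) x :=
    fun x hx => (hdiff x hx).hasDerivAt.add (hasDerivAt_id x)
  have := (convex_Icc α β).norm_image_sub_le_of_norm_hasDerivWithin_le
    (fun x hx => (hder x hx).hasDerivWithinAt) hhalf (right_mem_Icc.2 S.le) hx
  rw [h0, zero_add, Real.norm_eq_abs, Real.norm_eq_abs, abs_sub_comm x,
    abs_of_nonneg (show 0 ≤ β - x by linarith [hx.2])] at this
  have := (abs_le.1 this).1
  linarith

/-- Around every positive point there is a small interval. -/
lemma exists_smallInterval {R : ℝ} (hR : 0 < R) (hG0 : ∀ x, 0 ≤ G x)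
    (hG : ∀ s t, 0 < s → s ≤ t → IntervalIntegrable G volume s t) :
    ∃ ε > 0, ∀ α β, R - ε ≤ α → α ≤ β → β ≤ R + ε → SmallInterval G α β := by
  have hI : IntervalIntegrable G volume (R / 2) (2 * R) := hG _ _ (by linarith) (by linarith)
  have hcont : ContinuousAt (fun x => ∫ t in R..x, G t) R := by
    have := intervalIntegral.continuousOn_primitive_interval' hI
      (a := R) (by rw [uIcc_of_le (by linarith)]; constructor <;> linarith)
    refine this.continuousAt ?_
    rw [uIcc_of_le (by linarith)]
    exact Icc_mem_nhds (by linarith) (by linarith)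
  -- A bound of `1/8` on each side of `R` adds up to the required `1/4`.
  have hev := hcont.eventually (Metric.ball_mem_nhds _ (show (0 : ℝ) < 1 / 8 by norm_num))
  obtain ⟨ε, hε, hball⟩ := Metric.eventually_nhds_iff.1 hev
  have hm : 0 < min (min (ε / 2) (R / 2)) (1 / 2) := by positivity
  refine ⟨min (min (ε / 2) (R / 2)) (1 / 2), hm, fun α β hα hαβ hβ => ?_⟩
  set m := min (min (ε / 2) (R / 2)) (1 / 2) with hmdef
  have h1 : m ≤ ε / 2 := (min_le_left _ _).trans (min_le_left _ _)
  have h2 : m ≤ R / 2 := (min_le_left _ _).trans (min_le_right _ _)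
  have h3 : m ≤ 1 / 2 := min_le_right _ _
  have hα0 : 0 < α := by linarith
  have hbound : ∀ x, R - m ≤ x → x ≤ R + m → |∫ t in R..x, G t| < 1 / 8 := by
    intro x hx hx'
    have := hball (y := x) (by rw [Real.dist_eq, abs_lt]; constructor <;> linarith)
    simpa [Real.dist_eq] using this
  have hsub : ∀ x y, R - m ≤ x → x ≤ y → IntervalIntegrable G volume x y :=
    fun x y hx hy => hG _ _ (by linarith) hy
  have hβ' := abs_lt.1 (hbound (R + m) (by linarith) le_rfl)
  have hα' := abs_lt.1 (hbound (R - m) le_rfl (by linarith))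
  have hfull := hsub (R - m) (R + m) le_rfl (by linarith)
  refine ⟨hα0, hαβ, by linarith, hG0, hsub _ _ hα hαβ, ?_⟩
  refine (intervalIntegral_le_of_subinterval hfull hG0 hα hαβ hβ).trans ?_
  rw [← intervalIntegral.integral_add_adjacent_intervals
    (hsub (R - m) R le_rfl (by linarith)) (hsub R (R + m) (by linarith) (by linarith)),
    intervalIntegral.integral_symm R (R - m)]
  linarith

/-- A solution with finitely many zeros has simple zeros. -/
lemma IsSol.deriv_ne_zero (h : IsSol Q y b)
    (hQ : ∀ s t, 0 < s → s ≤ t → IntervalIntegrable Q volume s t) {z : ℝ} (hz : z ∈ Ioo 0 b)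
    (h0 : y z = 0) (hfin : (zerosUpTo y z).Finite) : deriv y z ≠ 0 := by
  intro h1
  obtain ⟨ε, hε, hS⟩ := exists_smallInterval (G := fun x => |Q x|) hz.1 (fun x => abs_nonneg _)
    (fun s t hs hst => (hQ s t hs hst).abs)
  have S := hS (z - ε) z le_rfl (by linarith) (by linarith)
  have hzero := h.eq_zero S hz.2 (fun x => le_rfl) h0 h1
  refine (Icc_infinite (show z - ε < z by linarith)).mono (fun x hx => ?_) hfin
  exact ⟨S.pos.trans_le hx.1, hx.2, hzero x hx⟩

end

/-! ### The energy along a line of zeros. -/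

section

/-- The coefficient of `ψ'' = Q ψ` in the radial equation. -/
noncomputable def radialQ (V : ℝ → ℝ) (ℓ E r : ℝ) : ℝ :=
  V r + ((ℓ + 1 / 2) ^ 2 - 1 / 4) / r ^ 2 - E

variable {V : ℝ → ℝ} {ℓ : ℝ}

lemma IntegrabilityConditions.intervalIntegrable (hV : IntegrabilityConditions V) (ℓ E : ℝ)
    {s t : ℝ} (hs : 0 < s) (hst : s ≤ t) :
    IntervalIntegrable (radialQ V ℓ E) volume s t := by
  have h1 : IntervalIntegrable V volume s t := by
    rw [intervalIntegrable_iff_integrableOn_Ioc_of_le hst]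
    exact (hV.2 s hs).mono_set Ioc_subset_Ioi_self
  have h2 : IntervalIntegrable (fun r : ℝ => ((ℓ + 1 / 2) ^ 2 - 1 / 4) / r ^ 2) volume s t := by
    refine ContinuousOn.intervalIntegrable (ContinuousOn.div continuousOn_const
      (continuousOn_pow 2) fun x hx => ?_)
    rw [uIcc_of_le hst] at hx
    have : 0 < x := hs.trans_le hx.1
    positivity
  exact (h1.add h2).sub intervalIntegrable_const

lemma IsRegularSolution.isSol {E : ℝ} {ψ : ℝ → ℝ} (h : IsRegularSolution V ℓ E ψ) (b : ℝ) :
    IsSol (radialQ V ℓ E) ψ b := IsRadialSolution.isSol h.toIsRadialSolution b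

lemma IsRegularSolution.regularAtZero {E : ℝ} {ψ : ℝ → ℝ} (h : IsRegularSolution V ℓ E ψ) :
    RegularAtZero ℓ ψ := h.cauchy

lemma IsNthZero.finite {ψ : ℝ → ℝ} {n : ℕ} {r : ℝ} (h : IsNthZero ψ n r) :
    (zerosUpTo ψ r).Finite := by
  refine finite_of_encard_eq_coe (k := n) ?_
  exact h.2.2

lemma IsNthZero.encard {ψ : ℝ → ℝ} {n : ℕ} {r : ℝ} (h : IsNthZero ψ n r) :
    (zerosUpTo ψ r).encard = n := h.2.2

/-- The `n`-th zero has fewer than `n` predecessors. -/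
lemma IsNthZero.not_le_encard {ψ : ℝ → ℝ} {n : ℕ} {r : ℝ} (h : IsNthZero ψ n r) {S : Set ℝ}
    (hS : ∀ s ∈ S, 0 < s ∧ s < r ∧ ψ s = 0) : ¬ (n : ℕ∞) ≤ S.encard := by
  intro hn
  have hr : r ∉ S := fun hr => lt_irrefl _ (hS r hr).2.1
  have hsub : insert r S ⊆ zerosUpTo ψ r := by
    rintro s (rfl | hs)
    · exact ⟨h.1, le_rfl, h.2.1⟩
    · exact ⟨(hS s hs).1, (hS s hs).2.1.le, (hS s hs).2.2⟩
  have h1 := encard_le_encard hsub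
  rw [encard_insert_of_notMem hr, h.encard] at h1
  have h2 : ((n : ℕ∞) + 1) ≤ n := (add_le_add_left hn 1).trans h1
  have h3 : ((n + 1 : ℕ) : ℕ∞) ≤ (n : ℕ∞) := by exact_mod_cast h2
  have := Nat.cast_le.1 h3
  omega

lemma radialQ_sub (V : ℝ → ℝ) (ℓ E E' x : ℝ) : radialQ V ℓ E' x - radialQ V ℓ E x = E - E' := by
  unfold radialQ; ring

/-- Along a line of zeros the energy strictly decreases with the position of the zero. -/
lemma energy_lt (hℓ : -1 / 2 ≤ ℓ) (hV : IntegrabilityConditions V) {n : ℕ} {E E' r r' : ℝ}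
    {u v : ℝ → ℝ} (hv : IsRegularSolution V ℓ E v) (hvz : IsNthZero v n r)
    (hu : IsRegularSolution V ℓ E' u) (huz : IsNthZero u n r') (hr : r < r') : E' < E := by
  by_contra! hE
  rcases hE.lt_or_eq with hlt | heq
  · have h := encard_zeros_le hℓ (hu.isSol (r + 1)) (hv.isSol (r + 1)) hu.regularAtZero
      hv.regularAtZero (κ := E' - E) (sub_pos.2 hlt)
      (Eventually.of_forall fun x _ => radialQ_sub V ℓ E' E x) (lt_add_one r) hvz.finite
    rw [hvz.encard] at h
    exact huz.not_le_encard (fun s hs => ⟨hs.1, hs.2.1.trans hr, hs.2.2⟩) h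
  -- At equal energies the Wronskian vanishes and the zeros of `v` are simple, so they are all zeros
  -- of `u`; then `u` has `n` zeros before `r'`.
  · subst heq
    refine huz.not_le_encard (S := zerosUpTo v r) (fun s hs => ⟨hs.1, hs.2.1.trans_lt hr, ?_⟩)
      hvz.encard.ge
    have hs1 : s ∈ Ioo 0 (s + 1) := ⟨hs.1, lt_add_one s⟩
    have hw := wr_eq_zero hℓ (hu.isSol (s + 1)) (hv.isSol (s + 1)) hu.regularAtZero
      hv.regularAtZero (Eventually.of_forall fun x _ => sub_self _) hs1
    have hd := (hv.isSol (s + 1)).deriv_ne_zero (fun _ _ => hV.intervalIntegrable ℓ E) hs1 hs.2.2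
      (hvz.finite.subset fun t ht => ⟨ht.1, ht.2.1.trans hs.2.1, ht.2.2⟩)
    unfold wr at hw
    rw [hs.2.2, mul_zero, sub_zero] at hw
    exact (mul_eq_zero.1 hw).resolve_right hd

/-- The multiple of `ψ` with derivative `-1` at `r`. -/
noncomputable def normalized (ψ : ℝ → ℝ) (r x : ℝ) : ℝ := -(deriv ψ r)⁻¹ * ψ x

lemma IsSol.normalized {Q ψ : ℝ → ℝ} {b : ℝ} (h : IsSol Q ψ b) (r : ℝ) :
    IsSol Q (normalized ψ r) b := h.const_mul _

lemma deriv_normalized {ψ : ℝ → ℝ} {r : ℝ} (h : deriv ψ r ≠ 0) :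
    deriv (normalized ψ r) r = -1 := by
  have : normalized ψ r = fun x => -(deriv ψ r)⁻¹ * ψ x := rfl
  rw [this, deriv_const_mul_field, neg_mul, inv_mul_cancel₀ h]

lemma normalized_eq_zero {ψ : ℝ → ℝ} {r x : ℝ} (h : ψ x = 0) : normalized ψ r x = 0 := by
  unfold normalized; rw [h, mul_zero]

lemma ne_zero_of_normalized_pos {ψ : ℝ → ℝ} {r x : ℝ} (h : 0 < normalized ψ r x) : ψ x ≠ 0 :=
  fun h0 => h.ne' (normalized_eq_zero h0)

lemma IsNthZero.deriv_ne_zero (hV : IntegrabilityConditions V) {n : ℕ} {E r : ℝ}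
    {u : ℝ → ℝ} (hu : IsRegularSolution V ℓ E u) (huz : IsNthZero u n r) : deriv u r ≠ 0 :=
  (hu.isSol (r + 1)).deriv_ne_zero (fun _ _ => hV.intervalIntegrable ℓ E)
    ⟨huz.1, lt_add_one r⟩ huz.2.1 huz.finite

lemma integral_sq_half (α r : ℝ) : ∫ s in α..r, ((r - s) / 2) ^ 2 = (r - α) ^ 3 / 12 := by
  rw [intervalIntegral.integral_eq_sub_of_hasDerivAt (f := fun s => -((r - s) ^ 3 / 12))]
  · ring
  · intro x _
    have := ((((hasDerivAt_id x).const_sub r).pow 3).div_const 12).neg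
    refine this.congr_deriv ?_
    simp only [id]
    ring
  · exact (by fun_prop : Continuous fun s : ℝ => ((r - s) / 2) ^ 2).intervalIntegrable _ _

/-- Along a line of zeros the energy is locally Lipschitz continuous. -/
lemma energy_sub_le (hℓ : -1 / 2 ≤ ℓ) (hV : IntegrabilityConditions V) {n : ℕ} {E E' r r' : ℝ}
    {u v : ℝ → ℝ} (hu : IsRegularSolution V ℓ E u) (huz : IsNthZero u n r)
    (hv : IsRegularSolution V ℓ E' v) (hvz : IsNthZero v n r') {G : ℝ → ℝ} {α : ℝ}
    (S : SmallInterval G α r') (hG : ∀ x, |radialQ V ℓ E x| ≤ G x)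
    (hG' : ∀ x, |radialQ V ℓ E' x| ≤ G x) (hα : α < r) (hr : r < r') :
    (E - E') * (r - α) ^ 3 ≤ 24 * (r' - r) := by
  have hE : 0 < E - E' := sub_pos.2 (energy_lt hℓ hV hu huz hv hvz hr)
  have hu' := huz.deriv_ne_zero hV hu
  have hv' := hvz.deriv_ne_zero hV hv
  have hsu := hu.isSol (r' + 1)
  have hsv := hv.isSol (r' + 1)
  have hQ : ∀ᵐ x, x ∈ Ioo 0 (r' + 1) → radialQ V ℓ E' x - radialQ V ℓ E x = E - E' :=
    Eventually.of_forall fun x _ => radialQ_sub V ℓ E E' x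
  have hub := (hsu.normalized r).unit_bounds (S.sub le_rfl hα.le hr.le)
    (hr.trans (lt_add_one r')) hG (normalized_eq_zero huz.2.1) (deriv_normalized hu')
  have hvb := (hsv.normalized r').unit_bounds S (lt_add_one r') hG'
    (normalized_eq_zero hvz.2.1) (deriv_normalized hv')
  obtain ⟨p, hp, hpr, hp0⟩ := exists_previous_zero hvz.1 hvz.finite
  have hvpos : ∀ x, α ≤ x → x < r' → 0 < normalized v r' x := fun x hx hx' => by
    have := (hvb x ⟨hx, hx'.le⟩).2.2.1
    linarith
  have hupos : ∀ x, α ≤ x → x < r → 0 < normalized u r x := fun x hx hx' => by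
    have := (hub x ⟨hx, hx'.le⟩).2.2.1
    linarith
  have hpα : p < α := by
    rcases hp with rfl | ⟨-, hp⟩
    · exact S.pos
    · by_contra! h
      exact ne_zero_of_normalized_pos (hvpos p h hpr) hp
  have hpnn : 0 ≤ p := by rcases hp with h | h <;> linarith [h]
  -- `v` has at least `n - 1` zeros up to `p`, so `u`, of larger energy, has at least as many before
  -- `p`. One more in `(p, r)` would make `n` zeros of `u` before its `n`-th one.
  have hu0 : ∀ t ∈ Ioo p r, u t ≠ 0 := by
    intro y hy hy0
    have hcount := encard_zeros_le hℓ hsu hsv hu.regularAtZero hv.regularAtZero hE hQ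
      (x := p) (by linarith) (hvz.finite.subset fun t ht => ⟨ht.1, ht.2.1.trans hpr.le, ht.2.2⟩)
    have hins : zerosUpTo v r' ⊆ insert r' (zerosUpTo v p) := by
      intro s hs
      rcases hs.2.1.eq_or_lt with h | h
      · exact Or.inl h
      · refine Or.inr ⟨hs.1, ?_, hs.2.2⟩
        by_contra! hps
        exact hp0 s ⟨hps, h⟩ hs.2.2
    have h1 := (encard_le_encard hins).trans (encard_insert_le _ _)
    rw [hvz.encard] at h1
    refine huz.not_le_encard (S := insert y {s | 0 < s ∧ s < p ∧ u s = 0}) ?_ ?_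
    · rintro s (rfl | hs)
      · exact ⟨hpnn.trans_lt hy.1, hy.2, hy0⟩
      · exact ⟨hs.1, hs.2.1.trans (hy.1.trans hy.2), hs.2.2⟩
    · rw [encard_insert_of_notMem (fun h => lt_asymm h.2.1 hy.1)]
      exact h1.trans (add_le_add_left hcount 1)
  have hw := wr_mul_nonneg hℓ hsu hsv hu.regularAtZero hv.regularAtZero hE.le hQ hp
    (hr.trans (lt_add_one r')).le hu0 (fun t ht => hp0 t ⟨ht.1, ht.2.trans hr⟩)
    (t := α) ⟨hpα, hα⟩
  have hwn : 0 ≤ wr (normalized u r) (normalized v r') α := by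
    have h1 := mul_pos (hupos α le_rfl hα) (hvpos α le_rfl (hα.trans hr))
    have h2 : wr (normalized u r) (normalized v r') α = _ :=
      wr_const_mul u v (-(deriv u r)⁻¹) (-(deriv v r')⁻¹) α
    have h3 : 0 ≤ wr (normalized u r) (normalized v r') α *
        (normalized u r α * normalized v r' α) := by
      rw [h2]
      unfold normalized
      have := mul_nonneg (mul_self_nonneg (-(deriv u r)⁻¹ * -(deriv v r')⁻¹)) hw
      calc 0 ≤ _ := this
        _ = _ := by ring
    exact nonneg_of_mul_nonneg_left h3 h1
  have hftc := (hsu.normalized r).wr_ftc_const (hsv.normalized r') hQ S.pos hα.le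
    (hr.trans (lt_add_one r'))
  -- Between `α` and `r` the Wronskian rises from a nonnegative value to `v(r) ≤ 2 (r' - r)`, and
  -- the rise is at least `(E - E') (r - α)³ / 12`; hence the constant `24`.
  have hwr : wr (normalized u r) (normalized v r') r = normalized v r' r := by
    unfold wr
    rw [normalized_eq_zero huz.2.1, deriv_normalized hu']
    ring
  have hint : (r - α) ^ 3 / 12 ≤ ∫ x in α..r, normalized u r x * normalized v r' x := by
    rw [← integral_sq_half]
    refine intervalIntegral.integral_mono_on hα.le
      ((by fun_prop : Continuous fun s : ℝ => ((r - s) / 2) ^ 2).intervalIntegrable _ _)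
      ((hsu.normalized r).intervalIntegrable_mul (hsv.normalized r') S.pos hα.le
        (hr.trans (lt_add_one r'))) (fun x hx => ?_)
    rw [sq]
    have h1 := (hub x hx).2.2.1
    have h2 := (hvb x ⟨hx.1, hx.2.trans hr.le⟩).2.2.1
    exact mul_le_mul h1 (by linarith) (by linarith [hx.2]) (by linarith [hx.2])
  have h2 := (hvb r ⟨hα.le, hr.le⟩).2.2.2
  have h3 := mul_le_mul_of_nonneg_left hint hE.le
  linarith

end

/-! ### The Volterra equation and local uniqueness. -/

section

/-- For each `r ∈ (R, β]`, a solution at energy `E r` that vanishes at `r` with slope `-1`, where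
the energy is Lipschitz continuous and the coefficients are dominated by `G`. -/
structure BackwardFamily (G q E : ℝ → ℝ) (φ : ℝ → ℝ → ℝ) (K R β b : ℝ) : Prop where
  sol : ∀ r ∈ Ioc R β, IsSol (fun x => q x - E r) (φ r) b
  zero : ∀ r ∈ Ioc R β, φ r r = 0
  slope : ∀ r ∈ Ioc R β, deriv (φ r) r = -1
  bound : ∀ r ∈ Ioc R β, ∀ x, |q x - E r| ≤ G x
  lip : ∀ r r', R < r → r < r' → r' ≤ β → |E r - E r'| ≤ K * (r' - r)

variable {G q q₁ q₂ E : ℝ → ℝ} {φ φ₁ φ₂ : ℝ → ℝ → ℝ} {K R β b : ℝ}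

lemma BackwardFamily.bounds (S : SmallInterval G R β) (hβ : β < b)
    (h : BackwardFamily G q E φ K R β b) {r : ℝ} (hr : r ∈ Ioc R β) {x : ℝ} (hx : x ∈ Icc R r) :
    |deriv (φ r) x + 1| ≤ 1 / 2 ∧ |deriv (φ r) x + 1| ≤ 2 * (r - x) ∧
      0 ≤ φ r x ∧ φ r x ≤ 2 * (r - x) := by
  have := (h.sol r hr).unit_bounds (S.sub le_rfl hr.1.le hr.2) (hr.2.trans_lt hβ)
    (h.bound r hr) (h.zero r hr) (h.slope r hr) x hx
  exact ⟨this.1, this.2.1, by linarith [this.2.2.1, hx.2], this.2.2.2⟩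

/-- Lipschitz dependence of a backward family on the position of the zero. -/
lemma BackwardFamily.sub_le (S : SmallInterval G R β) (hβ : β < b) (hK : 0 ≤ K)
    (h : BackwardFamily G q E φ K R β b) {r r' : ℝ} (hr : R < r) (hrr : r < r') (hr' : r' ≤ β)
    {x : ℝ} (hx : x ∈ Icc R r) :
    |deriv (φ r') x - deriv (φ r) x| ≤ (12 + 6 * K) * (r' - r) ∧
      |φ r' x - φ r x| ≤ (12 + 6 * K) * (r' - r) := by
  have hm : r ∈ Ioc R β := ⟨hr, hrr.le.trans hr'⟩
  have hm' : r' ∈ Ioc R β := ⟨hr.trans hrr, hr'⟩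
  have hs := h.sol r hm
  have hs' := h.sol r' hm'
  have hrb : r < b := hm.2.trans_lt hβ
  have hR : 0 < R := S.pos
  have hS := S.sub le_rfl hr.le hm.2
  have hdiff : ∀ x ∈ Icc R r, HasDerivAt (fun x => φ r' x - φ r x)
      (deriv (φ r') x - deriv (φ r) x) x := fun x hx =>
    (hs'.hasDerivAt ⟨hR.trans_le hx.1, hx.2.trans_lt hrb⟩).sub
      (hs.hasDerivAt ⟨hR.trans_le hx.1, hx.2.trans_lt hrb⟩)
  have hev : ∀ x ∈ Ioo 0 b, deriv (fun x => φ r' x - φ r x) =ᶠ[𝓝 x]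
      fun x => deriv (φ r') x - deriv (φ r) x := by
    intro x hx
    filter_upwards [isOpen_Ioo.mem_nhds hx] with y hy
    exact ((hs'.hasDerivAt hy).sub (hs.hasDerivAt hy)).deriv
  have hac0 : AbsolutelyContinuousOnInterval (fun x => deriv (φ r') x - deriv (φ r) x) R r :=
    (hs'.ac _ _ hR hr.le hrb).sub (hs.ac _ _ hR hr.le hrb)
  have hac : AbsolutelyContinuousOnInterval (deriv (fun x => φ r' x - φ r x)) R r := by
    refine hac0.congr' ?_
    refine eventually_inf_principal.2 (Eventually.of_forall fun I hI => ?_)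
    refine Finset.sum_congr rfl fun i hi => ?_
    have h1 := hI.1 i hi
    rw [uIcc_of_le hr.le] at h1
    rw [(hdiff _ h1.1).deriv, (hdiff _ h1.2).deriv]
  have hB := fun y (hy : y ∈ Icc R r) => h.bounds S hβ hm hy
  have hB' := h.bounds S hβ hm' (x := r) ⟨hr.le, hrr.le⟩
  -- The difference `d` satisfies `d'' = (q - E r') d + (E r - E r') φ r`, and both its value and
  -- its slope at `r` are at most `2 (r' - r)`. With `|φ r| ≤ 2` this gives the constant `3 (2 + 2 +
  -- 2 K)`.
  have hg := growth_bound (d := fun x => φ r' x - φ r x)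
    (g := fun x => (q x - E r') * φ r' x - (q x - E r) * φ r x) (P := G)
    (f := fun _ => 2 * (K * (r' - r))) (F := 2 * (K * (r' - r)))
    (D₀ := 2 * (r' - r)) (D₁ := 2 * (r' - r))
    hr.le hS.length (fun x hx => (hdiff x hx).differentiableAt) hac ?_ ?_ S.nonneg
    (fun x _ => by have := mul_nonneg hK (sub_nonneg.2 hrr.le); linarith)
    hS.integrable intervalIntegrable_const hS.small ?_ ?_ ?_ x hx
  · rw [(hdiff x hx).deriv] at hg
    have h1 : 0 ≤ K * (r' - r) := mul_nonneg hK (sub_nonneg.2 hrr.le)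
    exact ⟨hg.1.trans (by linarith), hg.2.trans (by linarith)⟩
  · filter_upwards [hs.eqn_on hR hr.le hrb, hs'.eqn_on hR hr.le hrb] with y hy hy' hym
    have hyI := hym
    rw [uIcc_of_le hr.le] at hyI
    exact ((hy' hym).sub (hy hym)).congr_of_eventuallyEq
      (hev y ⟨hR.trans_le hyI.1, hyI.2.trans_lt hrb⟩)
  · intro y hy
    have h1 : (q y - E r') * φ r' y - (q y - E r) * φ r y =
        (q y - E r') * (φ r' y - φ r y) + (E r - E r') * φ r y := by ring
    rw [h1]
    refine (abs_add_le _ _).trans (add_le_add ?_ ?_)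
    · rw [abs_mul]
      exact mul_le_mul_of_nonneg_right (h.bound r' hm' y) (abs_nonneg _)
    · rw [abs_mul, mul_comm 2]
      have h2 := hB y hy
      refine mul_le_mul (h.lip r r' hr hrr hr') ?_ (abs_nonneg _)
        (mul_nonneg hK (sub_nonneg.2 hrr.le))
      rw [abs_of_nonneg h2.2.2.1]
      linarith [h2.2.2.2, hy.1, hS.length]
  · rw [intervalIntegral.integral_const, smul_eq_mul]
    have h1 : 0 ≤ K * (r' - r) := mul_nonneg hK (sub_nonneg.2 hrr.le)
    nlinarith [hS.length]
  · rw [h.zero r hm, sub_zero, abs_of_nonneg hB'.2.2.1]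
    exact hB'.2.2.2
  · rw [(hdiff r ⟨hr.le, le_rfl⟩).deriv, h.slope r hm, sub_neg_eq_add]
    exact hB'.2.1

/-- The second derivative of the product of two solutions. -/
noncomputable def productSecondDeriv (q₁ q₂ : ℝ → ℝ) (e : ℝ) (u v : ℝ → ℝ) (x : ℝ) : ℝ :=
  2 * (deriv u x * deriv v x) + ((q₁ x - e) + (q₂ x - e)) * (u x * v x)

/-- Two integrations by parts against the product of two solutions which both vanish at `r`. -/
lemma integral_mul_productSecondDeriv {W : ℝ → ℝ} {e r : ℝ} {u v : ℝ → ℝ}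
    (hu : IsSol (fun x => q₁ x - e) u b) (hv : IsSol (fun x => q₂ x - e) v b) (hR : 0 < R)
    (hRr : R ≤ r) (hrb : r < b) (hW : IntervalIntegrable W volume R r) (hu0 : u r = 0)
    (hv0 : v r = 0) :
    IntervalIntegrable (fun x => (∫ t in R..x, ∫ s in R..t, W s) *
      productSecondDeriv q₁ q₂ e u v x) volume R r ∧
    ∫ x in R..r, (∫ t in R..x, ∫ s in R..t, W s) * productSecondDeriv q₁ q₂ e u v x =
      ∫ x in R..r, W x * (u x * v x) := by
  set w₁ : ℝ → ℝ := fun t => ∫ s in R..t, W s with hw₁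
  set w₂ : ℝ → ℝ := fun x => ∫ t in R..x, w₁ t with hw₂
  have hac₁ : AbsolutelyContinuousOnInterval w₁ R r :=
    hW.absolutelyContinuousOnInterval_intervalIntegral left_mem_uIcc
  have hi₁ : IntervalIntegrable w₁ volume R r := hac₁.continuousOn.intervalIntegrable
  have hac₂ : AbsolutelyContinuousOnInterval w₂ R r :=
    hi₁.absolutelyContinuousOnInterval_intervalIntegral left_mem_uIcc
  have hacu := hu.ac_self hR hRr hrb
  have hacv := hv.ac_self hR hRr hrb
  have hacu' := hu.ac _ _ hR hRr hrb
  have hacv' := hv.ac _ _ hR hRr hrb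
  have hWK : IntervalIntegrable (fun x => W x * (u x * v x)) volume R r :=
    hW.mul_continuousOn (hacu.continuousOn.mul hacv.continuousOn)
  -- The bracket from both integrations by parts vanishes at each end: the primitives are zero at
  -- `R`, while `u v` and `(u v)'` are zero at `r`.
  have hftc := ac_ftc
    (f := fun x => w₁ x * (u x * v x) - w₂ x * (deriv u x * v x + u x * deriv v x))
    (g := fun x => W x * (u x * v x) - w₂ x * productSecondDeriv q₁ q₂ e u v x)
    ((hac₁.fun_mul (hacu.fun_mul hacv)).fun_sub
      (hac₂.fun_mul ((hacu'.fun_mul hacv).fun_add (hacu.fun_mul hacv')))) (by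
    filter_upwards [hu.eqn_on hR hRr hrb, hv.eqn_on hR hRr hrb, hW.ae_hasDerivAt_integral,
      hi₁.ae_hasDerivAt_integral] with x h1 h2 h3 h4 hx
    have hxI := hx
    rw [uIcc_of_le hRr] at hxI
    have hxb : x ∈ Ioo 0 b := ⟨hR.trans_le hxI.1, hxI.2.trans_lt hrb⟩
    have d1 : HasDerivAt w₁ (W x) x := h3 hx R left_mem_uIcc
    have d2 : HasDerivAt w₂ (w₁ x) x := h4 hx R left_mem_uIcc
    have du := hu.hasDerivAt hxb
    have dv := hv.hasDerivAt hxb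
    have := (d1.fun_mul (du.fun_mul dv)).fun_sub
      (d2.fun_mul (((h1 hx).fun_mul dv).fun_add (du.fun_mul (h2 hx))))
    refine this.congr_deriv ?_
    unfold productSecondDeriv
    ring)
  have hi : IntervalIntegrable (fun x => w₂ x * productSecondDeriv q₁ q₂ e u v x) volume R r := by
    have := hWK.sub hftc.1
    refine this.congr_ae (Eventually.of_forall fun x => ?_)
    simp
  refine ⟨hi, ?_⟩
  have h1 := hftc.2
  rw [intervalIntegral.integral_sub hWK hi] at h1
  have e1 : w₁ R = 0 := intervalIntegral.integral_same
  have e2 : w₂ R = 0 := intervalIntegral.integral_same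
  simp only [hu0, hv0, e1, e2, mul_zero, zero_mul, add_zero, sub_zero] at h1
  linarith

/-- Lipschitz dependence of the kernel on the position of the zero. -/
lemma productSecondDeriv_sub_le (S : SmallInterval G R β) (hβ : β < b) (hK : 0 ≤ K)
    (h₁ : BackwardFamily G q₁ E φ₁ K R β b) (h₂ : BackwardFamily G q₂ E φ₂ K R β b)
    {r r' : ℝ} (hr : R < r) (hrr : r < r') (hr' : r' ≤ β) {x : ℝ} (hx : x ∈ Icc R r) :
    |productSecondDeriv q₁ q₂ (E r') (φ₁ r') (φ₂ r') x -
        productSecondDeriv q₁ q₂ (E r) (φ₁ r) (φ₂ r) x| ≤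
      (r' - r) * ((6 + 8 * G x) * (12 + 6 * K) + 8 * K) := by
  have hm : r ∈ Ioc R β := ⟨hr, hrr.le.trans hr'⟩
  have hm' : r' ∈ Ioc R β := ⟨hr.trans hrr, hr'⟩
  have hx' : x ∈ Icc R r' := ⟨hx.1, hx.2.trans hrr.le⟩
  obtain ⟨a1, -, a2, a3⟩ := h₁.bounds S hβ hm hx
  obtain ⟨b1, -, b2, b3⟩ := h₂.bounds S hβ hm hx
  obtain ⟨a1', -, a2', a3'⟩ := h₁.bounds S hβ hm' hx'
  obtain ⟨b1', -, b2', b3'⟩ := h₂.bounds S hβ hm' hx'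
  obtain ⟨c1, c2⟩ := h₁.sub_le S hβ hK hr hrr hr' hx
  obtain ⟨d1, d2⟩ := h₂.sub_le S hβ hK hr hrr hr' hx
  have hlen : r' - x ≤ 1 := by linarith [S.length, hx.1]
  have hh : 0 < r' - r := sub_pos.2 hrr
  set D := (12 + 6 * K) * (r' - r) with hD
  have hD0 : 0 ≤ D := by positivity
  have hder : ∀ a : ℝ, |a + 1| ≤ 1 / 2 → |a| ≤ 3 / 2 := fun a ha => by
    rw [abs_le] at ha ⊢; constructor <;> linarith
  have prod_sub : ∀ {a a' c c' B : ℝ}, |a'| ≤ B → |c| ≤ B → |a' - a| ≤ D → |c' - c| ≤ D →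
      |a' * c' - a * c| ≤ 2 * B * D := by
    intro a a' c c' B ha' hc hd1 hd2
    have hB : 0 ≤ B := (abs_nonneg _).trans ha'
    have : a' * c' - a * c = a' * (c' - c) + (a' - a) * c := by ring
    rw [this]
    refine (abs_add_le _ _).trans ?_
    rw [abs_mul, abs_mul]
    have e1 := mul_le_mul ha' hd2 (abs_nonneg _) hB
    have e2 := mul_le_mul hd1 hc (abs_nonneg _) hD0
    linarith
  have p1 := prod_sub (hder _ a1') (hder _ b1) c1 d1
  have p2 := prod_sub (B := 2) (by rw [abs_of_nonneg a2']; linarith)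
    (by rw [abs_of_nonneg b2]; linarith) c2 d2
  have hQ : |(q₁ x - E r') + (q₂ x - E r')| ≤ 2 * G x := by
    have := abs_add_le (q₁ x - E r') (q₂ x - E r')
    linarith [h₁.bound r' hm' x, h₂.bound r' hm' x]
  have hE := h₁.lip r r' hr hrr hr'
  have hP : |φ₁ r x * φ₂ r x| ≤ 4 := by
    rw [abs_mul, abs_of_nonneg a2, abs_of_nonneg b2]
    nlinarith
  have hG := S.nonneg x
  have key : productSecondDeriv q₁ q₂ (E r') (φ₁ r') (φ₂ r') x -
      productSecondDeriv q₁ q₂ (E r) (φ₁ r) (φ₂ r) x =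
      2 * (deriv (φ₁ r') x * deriv (φ₂ r') x - deriv (φ₁ r) x * deriv (φ₂ r) x) +
      ((q₁ x - E r') + (q₂ x - E r')) * (φ₁ r' x * φ₂ r' x - φ₁ r x * φ₂ r x) +
      2 * ((E r - E r') * (φ₁ r x * φ₂ r x)) := by
    unfold productSecondDeriv; ring
  rw [key]
  have e2 : |((q₁ x - E r') + (q₂ x - E r')) * (φ₁ r' x * φ₂ r' x - φ₁ r x * φ₂ r x)| ≤
      2 * G x * (2 * 2 * D) := by
    rw [abs_mul]
    exact mul_le_mul hQ p2 (abs_nonneg _) (by positivity)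
  have e3 : |(E r - E r') * (φ₁ r x * φ₂ r x)| ≤ K * (r' - r) * 4 := by
    rw [abs_mul]
    exact mul_le_mul hE hP (abs_nonneg _) (by positivity)
  refine (abs_add_le _ _).trans ((add_le_add_left (abs_add_le _ _) _).trans ?_)
  rw [abs_mul 2, abs_mul 2, abs_two]
  have : (r' - r) * ((6 + 8 * G x) * (12 + 6 * K) + 8 * K) =
      2 * (2 * (3 / 2) * D) + 2 * G x * (2 * 2 * D) + 2 * (K * (r' - r) * 4) := by
    rw [hD]; ring
  linarith

/-- A Volterra type uniqueness argument: a continuous function orthogonal to the kernels on all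
intervals `(R, r)` vanishes near `R`. -/
lemma eq_zero_of_integral_eq_zero (S : SmallInterval G R β) (hRβ : R < β) (hβ : β < b)
    (hK : 0 ≤ K) (h₁ : BackwardFamily G q₁ E φ₁ K R β b)
    (h₂ : BackwardFamily G q₂ E φ₂ K R β b) {w : ℝ → ℝ} (hw : ContinuousOn w (Icc R β))
    (hw0 : w R = 0)
    (hint : ∀ r ∈ Ioc R β, IntervalIntegrable
      (fun x => w x * productSecondDeriv q₁ q₂ (E r) (φ₁ r) (φ₂ r) x) volume R r)
    (hzero : ∀ r ∈ Ioc R β,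
      ∫ x in R..r, w x * productSecondDeriv q₁ q₂ (E r) (φ₁ r) (φ₂ r) x = 0) :
    ∃ β' ∈ Ioc R β, ∀ x ∈ Icc R β', w x = 0 := by
  set g : ℝ → ℝ := fun x => (6 + 8 * G x) * (12 + 6 * K) + 8 * K with hg
  have hg0 : ∀ x, 0 ≤ g x := fun x => by have := S.nonneg x; positivity
  have hgi : IntervalIntegrable g volume R β :=
    (((intervalIntegrable_const).add (S.integrable.const_mul 8)).mul_const _).add
      intervalIntegrable_const
  obtain ⟨β', hβ', hgsmall⟩ : ∃ β' ∈ Ioc R β, ∫ x in R..β', g x ≤ 1 / 8 := by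
    have hc := intervalIntegral.continuousOn_primitive_interval' hgi left_mem_uIcc
    rw [uIcc_of_le hRβ.le] at hc
    have hc' := (hc R ⟨le_rfl, hRβ.le⟩).tendsto
    rw [intervalIntegral.integral_same] at hc'
    have hev := hc'.eventually_le_const (show (0 : ℝ) < 1 / 8 by norm_num)
    have hev' : ∀ᶠ x in 𝓝[>] R, ∫ t in R..x, g t ≤ 1 / 8 := by
      rw [← nhdsWithin_Ioc_eq_nhdsGT hRβ]
      exact hev.filter_mono (nhdsWithin_mono _ Ioc_subset_Icc_self)
    obtain ⟨x, hx1, hx2⟩ := (hev'.and (Ioc_mem_nhdsGT hRβ)).exists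
    exact ⟨x, hx2, hx1⟩
  refine ⟨β', hβ', ?_⟩
  have hwc : ContinuousOn w (Icc R β') := hw.mono (Icc_subset_Icc_right hβ'.2)
  obtain ⟨ρ, hρ, hmax⟩ := isCompact_Icc.exists_isMaxOn (nonempty_Icc.2 hβ'.1.le) hwc.abs
  suffices hM : |w ρ| = 0 by
    intro x hx
    have : |w x| ≤ |w ρ| := hmax hx
    rw [hM] at this
    exact abs_eq_zero.1 (le_antisymm this (abs_nonneg _))
  by_contra hne
  set M := |w ρ| with hMdef
  have hM : 0 < M := lt_of_le_of_ne (abs_nonneg _) (Ne.symm hne)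
  have hρR : R < ρ := by
    rcases hρ.1.eq_or_lt with h | h
    · rw [← h, hw0, abs_zero] at hMdef
      exact absurd hMdef hne
    · exact h
  have hρm : ρ ∈ Ioc R β := ⟨hρR, hρ.2.trans hβ'.2⟩
  obtain ⟨σ, hσ, hσρ⟩ : ∃ σ : ℝ, |σ| = 1 ∧ σ * w ρ = M := by
    rcases le_total 0 (w ρ) with h | h
    · exact ⟨1, by simp, by rw [hMdef, abs_of_nonneg h, one_mul]⟩
    · exact ⟨-1, by simp, by rw [hMdef, abs_of_nonpos h]; ring⟩
  obtain ⟨ε, hε, hnear⟩ : ∃ ε > 0, ∀ x ∈ Icc R β', |x - ρ| < ε → M / 2 ≤ σ * w x := by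
    have hc : ContinuousWithinAt (fun x => σ * w x) (Icc R β') ρ :=
      (hwc ρ hρ).const_mul σ
    have := hc.tendsto.eventually_const_le (u := M / 2) (by rw [hσρ]; linarith)
    obtain ⟨ε, hε, hsub⟩ := Metric.mem_nhdsWithin_iff.1 this
    exact ⟨ε, hε, fun x hx hd => hsub ⟨by rwa [Metric.mem_ball, Real.dist_eq], hx⟩⟩
  -- The final comparison reads `M h / 4 - 2 M h² ≤ M h / 8`, which fails exactly when `h < 1/16`.
  obtain ⟨h, hh, hh1⟩ := exists_between (show 0 < min (min ε (ρ - R)) (1 / 16) from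
    lt_min (lt_min hε (sub_pos.2 hρR)) (by norm_num))
  have hhε : h < ε := hh1.trans_le ((min_le_left _ _).trans (min_le_left _ _))
  have hhR : h < ρ - R := hh1.trans_le ((min_le_left _ _).trans (min_le_right _ _))
  have hh16 : h < 1 / 16 := hh1.trans_le (min_le_right _ _)
  set r := ρ - h with hr
  have hrR : R < r := by linarith
  have hrρ : r < ρ := by linarith
  have hrm : r ∈ Ioc R β := ⟨hrR, hrρ.le.trans hρm.2⟩
  set H : ℝ → ℝ → ℝ := fun r x => productSecondDeriv q₁ q₂ (E r) (φ₁ r) (φ₂ r) x with hH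
  have i1 : IntervalIntegrable (fun x => w x * H ρ x) volume R r :=
    intervalIntegrable_of_subinterval (hint ρ hρm) le_rfl hrR.le hrρ.le
  have i2 : IntervalIntegrable (fun x => w x * H ρ x) volume r ρ :=
    intervalIntegrable_of_subinterval (hint ρ hρm) hrR.le hrρ.le le_rfl
  have i3 : IntervalIntegrable (fun x => w x * H r x) volume R r := hint r hrm
  -- The identities at `ρ` and `ρ - h` are subtracted rather than differentiated in `r`, since the
  -- kernel is only integrable in `x`. The strip near the maximum `ρ` of `|w|` contributes an amount
  -- of order `M h`, and the rest is small by the Lipschitz bound.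
  have hsum : ∫ x in r..ρ, w x * H ρ x = - ∫ x in R..r, w x * (H ρ x - H r x) := by
    have e1 := intervalIntegral.integral_add_adjacent_intervals i1 i2
    rw [hzero ρ hρm] at e1
    have e2 : ∫ x in R..r, w x * (H ρ x - H r x) =
        (∫ x in R..r, w x * H ρ x) - ∫ x in R..r, w x * H r x := by
      rw [← intervalIntegral.integral_sub i1 i3]
      exact intervalIntegral.integral_congr fun x _ => mul_sub _ _ _
    rw [hzero r hrm, sub_zero] at e2
    linarith
  have hsmall : |∫ x in R..r, w x * (H ρ x - H r x)| ≤ M * h * (1 / 8) := by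
    have hgi' : IntervalIntegrable (fun x => M * h * g x) volume R r :=
      (intervalIntegrable_of_subinterval hgi le_rfl hrR.le hrm.2).const_mul _
    have e1 := intervalIntegral.norm_integral_le_of_norm_le (μ := volume) hrR.le
      (f := fun x => w x * (H ρ x - H r x)) (g := fun x => M * h * g x)
      (Eventually.of_forall fun x hx => by
        rw [Real.norm_eq_abs, abs_mul, mul_assoc]
        have hx' : x ∈ Icc R r := Ioc_subset_Icc_self hx
        have e2 := productSecondDeriv_sub_le S hβ hK h₁ h₂ hrR hrρ hρm.2 hx'
        have e3 : ρ - r = h := by rw [hr]; ring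
        rw [e3] at e2
        have e4 : |w x| ≤ M := hmax ⟨hx'.1, hx'.2.trans (hrρ.le.trans hρ.2)⟩
        exact mul_le_mul e4 e2 (abs_nonneg _) hM.le) hgi'
    refine e1.trans ?_
    rw [intervalIntegral.integral_const_mul]
    refine mul_le_mul_of_nonneg_left ?_ (by positivity)
    exact (intervalIntegral_le_of_subinterval
      (intervalIntegrable_of_subinterval hgi le_rfl hβ'.1.le hβ'.2) hg0 le_rfl hrR.le
      (hrρ.le.trans hρ.2)).trans hgsmall
  have hlarge : M / 4 * h - M * (8 * h ^ 2) * (1 / 4) ≤ σ * ∫ x in r..ρ, w x * H ρ x := by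
    have hGi := intervalIntegrable_of_subinterval S.integrable hrR.le hrρ.le hρm.2
    have e1 : ∫ x in r..ρ, (M / 4 - M * (8 * h ^ 2) * G x) =
        M / 4 * h - M * (8 * h ^ 2) * ∫ x in r..ρ, G x := by
      rw [intervalIntegral.integral_sub intervalIntegrable_const (hGi.const_mul _),
        intervalIntegral.integral_const_mul, intervalIntegral.integral_const, smul_eq_mul]
      rw [hr]; ring
    have e2 : ∫ x in r..ρ, G x ≤ 1 / 4 := (S.sub hrR.le hrρ.le hρm.2).small
    have e3 : ∫ x in r..ρ, (M / 4 - M * (8 * h ^ 2) * G x) ≤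
        ∫ x in r..ρ, σ * (w x * H ρ x) := by
      refine intervalIntegral.integral_mono_on hrρ.le
        (intervalIntegrable_const.sub (hGi.const_mul _)) (i2.const_mul σ) (fun x hx => ?_)
      have hxρ : x ∈ Icc R ρ := ⟨hrR.le.trans hx.1, hx.2⟩
      have hxβ : x ∈ Icc R β' := ⟨hxρ.1, hxρ.2.trans hρ.2⟩
      obtain ⟨a1, -, a2, a3⟩ := h₁.bounds S hβ hρm hxρ
      obtain ⟨b1, -, b2, b3⟩ := h₂.bounds S hβ hρm hxρ
      have hxh : ρ - x ≤ h := by linarith [hx.1]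
      have hwx : M / 2 ≤ σ * w x := by
        refine hnear x hxβ ?_
        rw [abs_lt]; constructor <;> linarith [hx.1, hx.2]
      have hwM : |σ * w x| ≤ M := by
        rw [abs_mul, hσ, one_mul]; exact hmax hxβ
      have hQ : |(q₁ x - E ρ) + (q₂ x - E ρ)| ≤ 2 * G x := by
        have := abs_add_le (q₁ x - E ρ) (q₂ x - E ρ)
        linarith [h₁.bound ρ hρm x, h₂.bound ρ hρm x]
      have hP : |φ₁ ρ x * φ₂ ρ x| ≤ 4 * h ^ 2 := by
        rw [abs_mul, abs_of_nonneg a2, abs_of_nonneg b2]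
        calc φ₁ ρ x * φ₂ ρ x ≤ (2 * h) * (2 * h) :=
              mul_le_mul (by linarith) (by linarith) b2 (by linarith)
          _ = 4 * h ^ 2 := by ring
      have f1 : |σ * w x * (((q₁ x - E ρ) + (q₂ x - E ρ)) * (φ₁ ρ x * φ₂ ρ x))| ≤
          M * (2 * G x * (4 * h ^ 2)) := by
        rw [abs_mul, abs_mul (_ + _)]
        have := S.nonneg x
        exact mul_le_mul hwM (mul_le_mul hQ hP (abs_nonneg _) (by positivity))
          (by positivity) hM.le
      have f2 : 1 / 4 ≤ deriv (φ₁ ρ) x * deriv (φ₂ ρ) x := by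
        have := abs_le.1 a1
        have := abs_le.1 b1
        nlinarith
      have f3 : M / 2 * (1 / 4) ≤ σ * w x * (deriv (φ₁ ρ) x * deriv (φ₂ ρ) x) :=
        mul_le_mul hwx f2 (by norm_num) (by linarith)
      have f4 : σ * (w x * H ρ x) = 2 * (σ * w x * (deriv (φ₁ ρ) x * deriv (φ₂ ρ) x)) +
          σ * w x * (((q₁ x - E ρ) + (q₂ x - E ρ)) * (φ₁ ρ x * φ₂ ρ x)) := by
        simp only [hH, productSecondDeriv]; ring
      rw [f4]
      have := (abs_le.1 f1).1
      linarith
    rw [intervalIntegral.integral_const_mul, e1] at e3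
    have := mul_le_mul_of_nonneg_left e2 (show 0 ≤ M * (8 * h ^ 2) by positivity)
    linarith
  have hfin : σ * ∫ x in r..ρ, w x * H ρ x ≤ M * h * (1 / 8) := by
    refine (le_abs_self _).trans ?_
    rw [abs_mul, hσ, one_mul, hsum, abs_neg]
    exact hsmall
  have : 0 < M * h * (1 / 16 - h) := mul_pos (mul_pos hM hh) (sub_pos.2 hh16)
  nlinarith

/-- Local uniqueness: two families with the same energies whose Wronskians vanish at `R` come from
potentials that agree beyond `R` for a while. -/
lemma exists_ae_eq_right (S : SmallInterval G R β) (hRβ : R < β) (hβ : β < b)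
    (hK : 0 ≤ K) (h₁ : BackwardFamily G q₁ E φ₁ K R β b)
    (h₂ : BackwardFamily G q₂ E φ₂ K R β b)
    (hW : IntervalIntegrable (fun x => q₂ x - q₁ x) volume R β)
    (hwr : ∀ r ∈ Ioc R β, wr (φ₁ r) (φ₂ r) R = 0) :
    ∃ β' ∈ Ioc R β, ∀ᵐ x, x ∈ Ioo R β' → q₁ x = q₂ x := by
  have hR := S.pos
  set W : ℝ → ℝ := fun x => q₂ x - q₁ x with hWdef
  have hc₁ : ContinuousOn (fun t => ∫ s in R..t, W s) (Icc R β) := by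
    have := intervalIntegral.continuousOn_primitive_interval' hW left_mem_uIcc
    rwa [uIcc_of_le hRβ.le] at this
  have hi₁ : IntervalIntegrable (fun t => ∫ s in R..t, W s) volume R β := by
    refine ContinuousOn.intervalIntegrable ?_
    rwa [uIcc_of_le hRβ.le]
  have hc₂ : ContinuousOn (fun x => ∫ t in R..x, ∫ s in R..t, W s) (Icc R β) := by
    have := intervalIntegral.continuousOn_primitive_interval' hi₁ left_mem_uIcc
    rwa [uIcc_of_le hRβ.le] at this
  have hibp := fun r (hr : r ∈ Ioc R β) => integral_mul_productSecondDeriv (W := W)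
    (h₁.sol r hr) (h₂.sol r hr) hR hr.1.le (hr.2.trans_lt hβ)
    (intervalIntegrable_of_subinterval hW le_rfl hr.1.le hr.2) (h₁.zero r hr) (h₂.zero r hr)
  obtain ⟨β', hβ', hz⟩ := eq_zero_of_integral_eq_zero S hRβ hβ hK h₁ h₂ hc₂
    intervalIntegral.integral_same (fun r hr => (hibp r hr).1) (fun r hr => by
      rw [(hibp r hr).2]
      have := ((h₁.sol r hr).wr_ftc (h₂.sol r hr) hR hr.1.le (hr.2.trans_lt hβ)).2
      rw [hwr r hr] at this
      have e : wr (φ₁ r) (φ₂ r) r = 0 := by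
        unfold wr; rw [h₁.zero r hr, h₂.zero r hr]; ring
      rw [e, sub_zero] at this
      rw [← this]
      refine intervalIntegral.integral_congr fun x _ => ?_
      simp only [hWdef]
      ring)
  -- The double primitive vanishes, so its derivative does too; a second differentiation, almost
  -- everywhere, recovers `W = 0`.
  have hw₁ : ∀ x ∈ Ioo R β', ∫ s in R..x, W s = 0 := by
    intro x hx
    have hxβ : x ∈ Ioo R β := ⟨hx.1, hx.2.trans_le hβ'.2⟩
    have hd : HasDerivAt (fun x => ∫ t in R..x, ∫ s in R..t, W s) (∫ s in R..x, W s) x :=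
      intervalIntegral.integral_hasDerivAt_right
        (intervalIntegrable_of_subinterval hi₁ le_rfl hx.1.le hxβ.2.le)
        ((hc₁.mono Ioo_subset_Icc_self).stronglyMeasurableAtFilter isOpen_Ioo x hxβ)
        (hc₁.continuousAt (Icc_mem_nhds hxβ.1 hxβ.2))
    have hd0 : HasDerivAt (fun x => ∫ t in R..x, ∫ s in R..t, W s) 0 x := by
      refine (hasDerivAt_const x (0 : ℝ)).congr_of_eventuallyEq ?_
      filter_upwards [isOpen_Ioo.mem_nhds hx] with y hy using hz y (Ioo_subset_Icc_self hy)
    exact hd.unique hd0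
  refine ⟨β', hβ', ?_⟩
  filter_upwards [hW.ae_hasDerivAt_integral] with x hx hxm
  have hxβ : x ∈ uIcc R β := by
    rw [uIcc_of_le hRβ.le]; exact ⟨hxm.1.le, hxm.2.le.trans hβ'.2⟩
  have hd := hx hxβ R left_mem_uIcc
  have hd0 : HasDerivAt (fun x => ∫ s in R..x, W s) 0 x := by
    refine (hasDerivAt_const x (0 : ℝ)).congr_of_eventuallyEq ?_
    filter_upwards [isOpen_Ioo.mem_nhds hxm] with y hy using hw₁ y hy
  have := hd.unique hd0
  simp only [hWdef] at this
  linarith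

end

/-! ### Extending the agreement of the potentials beyond a radius. -/

section

/-- Regular solutions along a line of zeros: at energy `E r` the `n`-th zero is `r`. -/
def IsLineFamily (V : ℝ → ℝ) (ℓ : ℝ) (n : ℕ) (E : ℝ → ℝ) (ψ : ℝ → ℝ → ℝ) : Prop :=
  ∀ r, 0 < r → IsRegularSolution V ℓ (E r) (ψ r) ∧ IsNthZero (ψ r) n r

variable {V V₁ V₂ : ℝ → ℝ} {ℓ : ℝ} {n n₁ n₂ : ℕ} {E : ℝ → ℝ} {ψ ψ₁ ψ₂ : ℝ → ℝ → ℝ}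

lemma IsLineFamily.energy_lt (hℓ : -1 / 2 ≤ ℓ) (hV : IntegrabilityConditions V)
    (h : IsLineFamily V ℓ n E ψ) {r r' : ℝ} (hr : 0 < r) (hrr : r < r') : E r' < E r :=
  FixedEll.energy_lt hℓ hV (h r hr).1 (h r hr).2 (h r' (hr.trans hrr)).1 (h r' (hr.trans hrr)).2 hrr

lemma IsLineFamily.energy_le (hℓ : -1 / 2 ≤ ℓ) (hV : IntegrabilityConditions V)
    (h : IsLineFamily V ℓ n E ψ) {r r' : ℝ} (hr : 0 < r) (hrr : r ≤ r') : E r' ≤ E r := by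
  rcases hrr.eq_or_lt with rfl | hlt
  · exact le_rfl
  · exact (h.energy_lt hℓ hV hr hlt).le

lemma IsLineFamily.backwardFamily (hV : IntegrabilityConditions V) (h : IsLineFamily V ℓ n E ψ)
    {G : ℝ → ℝ} {K R β : ℝ} (hR : 0 < R)
    (hG : ∀ r ∈ Ioc R β, ∀ x, |radialQ V ℓ (E r) x| ≤ G x)
    (hlip : ∀ r r', R < r → r < r' → r' ≤ β → |E r - E r'| ≤ K * (r' - r)) :
    BackwardFamily G (fun x => V x + ((ℓ + 1 / 2) ^ 2 - 1 / 4) / x ^ 2) E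
      (fun r => normalized (ψ r) r) K R β (β + 1) where
  sol r hr := ((h r (hR.trans hr.1)).1.isSol (β + 1)).normalized r
  zero r hr := normalized_eq_zero (h r (hR.trans hr.1)).2.2.1
  slope r hr := deriv_normalized
    ((h r (hR.trans hr.1)).2.deriv_ne_zero hV (h r (hR.trans hr.1)).1)
  bound r hr := hG r hr
  lip := hlip

/-- If two potentials with a common line of zeros agree up to `R`, they agree a bit further. -/
lemma exists_ae_eq_extend (hℓ : -1 / 2 ≤ ℓ) (hV₁ : IntegrabilityConditions V₁)
    (hV₂ : IntegrabilityConditions V₂) (h₁ : IsLineFamily V₁ ℓ n₁ E ψ₁)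
    (h₂ : IsLineFamily V₂ ℓ n₂ E ψ₂) {R : ℝ} (hR : 0 < R)
    (heq : ∀ᵐ x, x ∈ Ioo 0 R → V₁ x = V₂ x) :
    ∃ β, R < β ∧ ∀ᵐ x, x ∈ Ioo 0 β → V₁ x = V₂ x := by
  set q : (ℝ → ℝ) → ℝ → ℝ := fun V x => V x + ((ℓ + 1 / 2) ^ 2 - 1 / 4) / x ^ 2 with hq
  set Λ := |E (R / 2)| + |E (2 * R)| with hΛ
  -- A single `G` dominates both coefficients at all energies `E r` with `R / 2 ≤ r ≤ 2 R`;
  -- monotonicity of `E` bounds these energies by `Λ`.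
  set G : ℝ → ℝ := fun x => |q V₁ x| + |q V₂ x| + Λ with hGdef
  have hΛ0 : 0 ≤ Λ := by positivity
  have hqi : ∀ {V : ℝ → ℝ}, IntegrabilityConditions V → ∀ s t, 0 < s → s ≤ t →
      IntervalIntegrable (q V) volume s t := by
    intro V hV s t hs hst
    have := hV.intervalIntegrable ℓ 0 hs hst
    refine this.congr_ae (Eventually.of_forall fun x => ?_)
    simp [radialQ, hq]
  have hG0 : ∀ x, 0 ≤ G x := fun x => by positivity
  obtain ⟨ε₀, hε₀, hS₀⟩ := exists_smallInterval (G := G) hR hG0 (fun s t hs hst =>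
    (((hqi hV₁ s t hs hst).abs).add ((hqi hV₂ s t hs hst).abs)).add intervalIntegrable_const)
  set ε := min ε₀ (R / 2) with hε
  have hε0 : 0 < ε := lt_min hε₀ (half_pos hR)
  have hεR : ε ≤ R / 2 := min_le_right _ _
  have hεε : ε ≤ ε₀ := min_le_left _ _
  have hEb : ∀ r, R / 2 ≤ r → r ≤ 2 * R → |E r| ≤ Λ := by
    intro r hr hr'
    have h1 := h₁.energy_le hℓ hV₁ (half_pos hR) hr
    have h2 := h₁.energy_le hℓ hV₁ (by linarith) hr'
    rw [abs_le]
    constructor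
    · linarith [neg_abs_le (E (2 * R)), abs_nonneg (E (R / 2))]
    · linarith [le_abs_self (E (R / 2)), abs_nonneg (E (2 * R))]
  have hQ₁ : ∀ r, R / 2 ≤ r → r ≤ 2 * R → ∀ x, |radialQ V₁ ℓ (E r) x| ≤ G x := by
    intro r hr hr' x
    have : |q V₁ x - E r| ≤ |q V₁ x| + |E r| := abs_sub _ _
    have h2 := hEb r hr hr'
    have h3 : |radialQ V₁ ℓ (E r) x| = |q V₁ x - E r| := rfl
    have h4 := abs_nonneg (q V₂ x)
    simp only [hGdef]
    linarith
  have hQ₂ : ∀ r, R / 2 ≤ r → r ≤ 2 * R → ∀ x, |radialQ V₂ ℓ (E r) x| ≤ G x := by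
    intro r hr hr' x
    have : |q V₂ x - E r| ≤ |q V₂ x| + |E r| := abs_sub _ _
    have h2 := hEb r hr hr'
    have h3 : |radialQ V₂ ℓ (E r) x| = |q V₂ x - E r| := rfl
    have h4 := abs_nonneg (q V₁ x)
    simp only [hGdef]
    linarith
  set β := R + ε with hβ
  have hlip : ∀ r r', R < r → r < r' → r' ≤ β → |E r - E r'| ≤ 24 / ε ^ 3 * (r' - r) := by
    intro r r' hr hrr hr'
    have hr0 : 0 < r := hR.trans hr
    have h1 := h₁.energy_lt hℓ hV₁ hr0 hrr
    rw [abs_of_pos (sub_pos.2 h1), div_mul_eq_mul_div, le_div_iff₀ (pow_pos hε0 3)]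
    -- The base point `R - ε` lies below `R`, so `r - α ≥ ε` and the Lipschitz constant stays
    -- uniform as `r` decreases to `R`.
    have h2 := energy_sub_le hℓ hV₁ (h₁ r hr0).1 (h₁ r hr0).2 (h₁ r' (hr0.trans hrr)).1
      (h₁ r' (hr0.trans hrr)).2 (hS₀ (R - ε) r' (by linarith) (by linarith) (by linarith))
      (hQ₁ r (by linarith) (by linarith)) (hQ₁ r' (by linarith) (by linarith))
      (by linarith) hrr
    refine le_trans (mul_le_mul_of_nonneg_left ?_ (sub_pos.2 h1).le) h2
    exact pow_le_pow_left₀ hε0.le (by linarith) 3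
  have S := hS₀ R β (by linarith) (by linarith) (by linarith)
  have B₁ := h₁.backwardFamily hV₁ hR
    (fun r hr => hQ₁ r (by linarith [hr.1]) (by linarith [hr.2])) hlip
  have B₂ := h₂.backwardFamily hV₂ hR
    (fun r hr => hQ₂ r (by linarith [hr.1]) (by linarith [hr.2])) hlip
  have hQeq : ∀ e, ∀ᵐ x, x ∈ Ioo 0 R → radialQ V₂ ℓ e x - radialQ V₁ ℓ e x = 0 := by
    intro e
    filter_upwards [heq] with x hx hx'
    unfold radialQ
    rw [hx hx', sub_self]
  have hwr : ∀ r ∈ Ioc R β, wr (normalized (ψ₁ r) r) (normalized (ψ₂ r) r) R = 0 := by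
    intro r hr
    have hr0 : 0 < r := hR.trans hr.1
    have h3 : wr (normalized (ψ₁ r) r) (normalized (ψ₂ r) r) R = _ :=
      wr_const_mul (ψ₁ r) (ψ₂ r) (-(deriv (ψ₁ r) r)⁻¹) (-(deriv (ψ₂ r) r)⁻¹) R
    have hu := (h₁ r hr0).1
    have hv := (h₂ r hr0).1
    -- The Wronskian vanishes at the interior point `R / 2`, and Lagrange's identity carries the
    -- zero up to `R`.
    have h4 := wr_eq_zero hℓ (hu.isSol R) (hv.isSol R) hu.regularAtZero hv.regularAtZero
      (hQeq (E r)) (x := R / 2) ⟨half_pos hR, half_lt_self hR⟩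
    have h5 := ((hu.isSol (R + 1)).wr_ftc (hv.isSol (R + 1)) (half_pos hR)
      (half_lt_self hR).le (lt_add_one R)).2
    have h6 : ∫ x in (R / 2)..R, (radialQ V₂ ℓ (E r) x - radialQ V₁ ℓ (E r) x) *
        (ψ₁ r x * ψ₂ r x) = 0 := by
      rw [intervalIntegral.integral_of_le (half_lt_self hR).le, integral_Ioc_eq_integral_Ioo]
      refine setIntegral_eq_zero_of_ae_eq_zero ?_
      filter_upwards [hQeq (E r)] with x hx hx'
      rw [hx ⟨(half_pos hR).trans hx'.1, hx'.2⟩, zero_mul]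
    rw [h3, show wr (ψ₁ r) (ψ₂ r) R = 0 by linarith, mul_zero]
  obtain ⟨β', hβ', hae⟩ := exists_ae_eq_right S (by linarith) (lt_add_one β) (by positivity)
    B₁ B₂ ((hqi hV₂ R β hR (by linarith)).sub (hqi hV₁ R β hR (by linarith))) hwr
  refine ⟨β', hβ'.1, ?_⟩
  filter_upwards [heq, hae, (volume : Measure ℝ).ae_ne R] with x hx hx' hne hm
  rcases lt_trichotomy x R with hlt | h | hgt
  · exact hx ⟨hm.1, hlt⟩
  · exact absurd h hne
  · have := hx' ⟨hgt, hm.2⟩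
    simpa using this

/-! ### Scaling near the origin and continuation to the half-line. -/

lemma ae_comp_const_mul {P : ℝ → Prop} (h : ∀ᵐ x, P x) {k : ℝ} (hk : k ≠ 0) :
    ∀ᵐ x : ℝ, P (k * x) := by
  have hq : Measure.QuasiMeasurePreserving (fun x : ℝ => k * x) volume volume := by
    refine ⟨measurable_const_mul k, ?_⟩
    rw [Real.map_volume_mul_left hk]
    exact Measure.smul_absolutelyContinuous
  exact hq.ae h

lemma ac_comp_const_mul {f : ℝ → ℝ} {k s t : ℝ} (hk : 0 < k)
    (hf : AbsolutelyContinuousOnInterval f (k * s) (k * t)) :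
    AbsolutelyContinuousOnInterval (fun x => f (k * x)) s t := by
  have hmem : ∀ x ∈ uIcc s t, k * x ∈ uIcc (k * s) (k * t) := by
    intro x hx
    rw [mem_uIcc] at hx ⊢
    rcases hx with ⟨h1, h2⟩ | ⟨h1, h2⟩
    · exact Or.inl ⟨mul_le_mul_of_nonneg_left h1 hk.le, mul_le_mul_of_nonneg_left h2 hk.le⟩
    · exact Or.inr ⟨mul_le_mul_of_nonneg_left h1 hk.le, mul_le_mul_of_nonneg_left h2 hk.le⟩
  have hi : IntervalIntegrable (fun x => deriv f (k * x)) volume s t := by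
    have := hf.intervalIntegrable_deriv.comp_mul_left (c := k)
    simpa [mul_div_cancel_left₀ _ hk.ne'] using this
  have hac := (hi.absolutelyContinuousOnInterval_intervalIntegral (c := s) left_mem_uIcc).const_mul k
  have hc : AbsolutelyContinuousOnInterval (fun _ : ℝ => f (k * s)) s t :=
    ((LipschitzWith.const (f (k * s))).lipschitzOnWith (s := uIcc s t)).absolutelyContinuousOnInterval
  refine (hc.fun_add hac).congr' ?_
  have key : ∀ x ∈ uIcc s t, f (k * s) + k * ∫ y in s..x, deriv f (k * y) = f (k * x) := by
    intro x hx
    have h1 := (hf.mono (uIcc_subset_uIcc left_mem_uIcc (hmem x hx))).integral_deriv_eq_sub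
    rw [intervalIntegral.mul_integral_comp_mul_left, h1]
    ring
  refine eventually_inf_principal.2 (Eventually.of_forall fun I hI => ?_)
  refine Finset.sum_congr rfl fun i hi => ?_
  have h1 := hI.1 i hi
  simp only
  rw [key _ h1.1, key _ h1.2]

/-- The condition `k ≤ 1` keeps `k x` inside `(0, b)`. -/
lemma IsSol.comp_const_mul {Q y : ℝ → ℝ} {b k : ℝ} (h : IsSol Q y b) (hk : 0 < k)
    (hk1 : k ≤ 1) : IsSol (fun x => k ^ 2 * Q (k * x)) (fun x => y (k * x)) b := by
  have hm : ∀ x ∈ Ioo 0 b, k * x ∈ Ioo 0 b := fun x hx =>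
    ⟨mul_pos hk hx.1, (mul_le_of_le_one_left hx.1.le hk1).trans_lt hx.2⟩
  have hd : deriv (fun x => y (k * x)) = fun x => k * deriv y (k * x) := by
    funext x
    have := deriv_comp_mul_left k y x
    simpa using this
  refine ⟨fun x hx => ?_, fun s t hs hst ht => ?_, ?_⟩
  · have h1 := (h.hasDerivAt (hm x hx)).comp x ((hasDerivAt_id x).const_mul k)
    exact h1.differentiableAt
  · rw [hd]
    refine AbsolutelyContinuousOnInterval.const_mul k (ac_comp_const_mul hk ?_)
    exact h.ac _ _ (mul_pos hk hs) (mul_le_mul_of_nonneg_left hst hk.le)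
      (hm t ⟨hs.trans_le hst, ht⟩).2
  · rw [hd]
    filter_upwards [ae_comp_const_mul h.eqn hk.ne'] with x hx hx'
    have h1 := ((hx (hm x hx')).comp x ((hasDerivAt_id x).const_mul k)).const_mul k
    refine h1.congr_deriv ?_
    ring

lemma RegularAtZero.comp_const_mul {u : ℝ → ℝ} {k : ℝ} (h : RegularAtZero ℓ u) (hk : 0 < k) :
    RegularAtZero ℓ (fun x => k ^ (-ℓ - 1) * u (k * x)) := by
  have ht : Tendsto (fun x : ℝ => k * x) (𝓝[>] 0) (𝓝[>] 0) := by
    refine tendsto_nhdsWithin_iff.2 ⟨?_, ?_⟩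
    · have : Tendsto (fun x : ℝ => k * x) (𝓝 0) (𝓝 (k * 0)) :=
        (continuous_const_mul k).tendsto 0
      rw [mul_zero] at this
      exact this.mono_left nhdsWithin_le_nhds
    · filter_upwards [self_mem_nhdsWithin] with x hx using mul_pos hk hx
  refine (h.comp ht).congr' ?_
  filter_upwards [self_mem_nhdsWithin] with x hx
  have hx0 : (0 : ℝ) < x := hx
  simp only [Function.comp]
  rw [Real.mul_rpow hk.le hx0.le]
  ring

lemma IsNthZero.comp_const_mul {u : ℝ → ℝ} {k m r : ℝ} (h : IsNthZero u n (k * r)) (hk : 0 < k)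
    (hm : m ≠ 0) : IsNthZero (fun x => m * u (k * x)) n r := by
  refine ⟨pos_of_mul_pos_right h.1 hk.le, by simp [h.2.1], ?_⟩
  have hset : (fun x => k * x) '' {s : ℝ | 0 < s ∧ s ≤ r ∧ m * u (k * s) = 0} =
      zerosUpTo u (k * r) := by
    ext x
    constructor
    · rintro ⟨s, ⟨h1, h2, h3⟩, rfl⟩
      exact ⟨mul_pos hk h1, mul_le_mul_of_nonneg_left h2 hk.le,
        (mul_eq_zero.1 h3).resolve_left hm⟩
    · rintro ⟨h1, h2, h3⟩
      have hx : k * (x / k) = x := mul_div_cancel₀ x hk.ne'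
      refine ⟨x / k, ⟨div_pos h1 hk, (div_le_iff₀' hk).2 h2, ?_⟩, hx⟩
      rw [hx, h3, mul_zero]
  rw [← (mul_right_injective₀ hk.ne').encard_image, hset]
  exact h.encard

/-- Where the potential is a constant `c`, the product `(E - c) r²` is constant along a line of
zeros. -/
lemma IsLineFamily.scaling (hℓ : -1 / 2 ≤ ℓ) (h : IsLineFamily V ℓ n E ψ) {c δ : ℝ}
    (hc : ∀ᵐ x, x ∈ Ioo 0 δ → V x = c) {r r' : ℝ} (hr : 0 < r) (hrr : r < r') (hr' : r' < δ) :
    (E r - c) * r ^ 2 = (E r' - c) * r' ^ 2 := by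
  have hr'0 : 0 < r' := hr.trans hrr
  -- Rescaling by `k` moves the zero `r` of `ψ r` to `r'`; the factor `k ^ (-ℓ - 1)` restores the
  -- normalization at the origin.
  set k := r / r' with hk
  have hk0 : 0 < k := div_pos hr hr'0
  have hk1 : k ≤ 1 := (div_le_one hr'0).2 hrr.le
  have hkr : k * r' = r := div_mul_cancel₀ r hr'0.ne'
  have hu := (h r hr).1
  have hv := (h r' hr'0).1
  have hm : k ^ (-ℓ - 1) ≠ 0 := (Real.rpow_pos_of_pos hk0 _).ne'
  have su := ((hu.isSol δ).comp_const_mul hk0 hk1).const_mul (k ^ (-ℓ - 1))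
  have cu := hu.regularAtZero.comp_const_mul hk0
  have zu : IsNthZero (fun x => k ^ (-ℓ - 1) * ψ r (k * x)) n r' := by
    refine IsNthZero.comp_const_mul ?_ hk0 hm
    rw [hkr]
    exact (h r hr).2
  have sv := hv.isSol δ
  have cv := hv.regularAtZero
  have zv := (h r' hr'0).2
  have hQ : ∀ᵐ x, x ∈ Ioo 0 δ → radialQ V ℓ (E r') x - k ^ 2 * radialQ V ℓ (E r) (k * x) =
      k ^ 2 * (E r - c) - (E r' - c) := by
    filter_upwards [hc, ae_comp_const_mul hc hk0.ne'] with x hx hx' hxm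
    have hx0 : 0 < x := hxm.1
    unfold radialQ
    rw [hx hxm, hx' ⟨mul_pos hk0 hx0, (mul_le_of_le_one_left hx0.le hk1).trans_lt hxm.2⟩]
    field_simp
    ring
  have hzero : k ^ 2 * (E r - c) - (E r' - c) = 0 := by
    -- Both functions have their `n`-th zero at `r'`. If the effective energies differed, the one
    -- with the larger energy would have `n` zeros strictly before `r'`.
    rcases lt_trichotomy (k ^ 2 * (E r - c) - (E r' - c)) 0 with hlt | h0 | hgt
    · have hQ' : ∀ᵐ x, x ∈ Ioo 0 δ →
          k ^ 2 * radialQ V ℓ (E r) (k * x) - radialQ V ℓ (E r') x =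
          -(k ^ 2 * (E r - c) - (E r' - c)) := by
        filter_upwards [hQ] with x hx hxm
        rw [← hx hxm]; ring
      have := encard_zeros_le hℓ sv su cv cu (neg_pos.2 hlt) hQ' hr' zu.finite
      rw [zu.encard] at this
      exact (zv.not_le_encard (fun s hs => hs) this).elim
    · exact h0
    · have := encard_zeros_le hℓ su sv cu cv hgt hQ hr' zv.finite
      rw [zv.encard] at this
      exact (zu.not_le_encard (fun s hs => hs) this).elim
  have h1 : k ^ 2 * r' ^ 2 = r ^ 2 := by rw [← mul_pow, hkr]
  calc (E r - c) * r ^ 2 = k ^ 2 * (E r - c) * r' ^ 2 := by rw [← h1]; ring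
    _ = (E r' - c) * r' ^ 2 := by rw [sub_eq_zero.1 hzero]

/-- Two potentials that are constant near the origin and share a line of zeros agree near the
origin. -/
lemma exists_ae_eq_near_zero (hℓ : -1 / 2 ≤ ℓ) (hc₁ : ConstantNearZero V₁)
    (hc₂ : ConstantNearZero V₂) (h₁ : IsLineFamily V₁ ℓ n₁ E ψ₁)
    (h₂ : IsLineFamily V₂ ℓ n₂ E ψ₂) :
    ∃ δ, 0 < δ ∧ ∀ᵐ x, x ∈ Ioo 0 δ → V₁ x = V₂ x := by
  obtain ⟨c₁, δ₁, hδ₁, hc₁⟩ := hc₁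
  obtain ⟨c₂, δ₂, hδ₂, hc₂⟩ := hc₂
  rw [ae_restrict_iff' measurableSet_Ioo] at hc₁ hc₂
  set δ := min δ₁ δ₂ with hδ
  have hδ0 : 0 < δ := lt_min hδ₁ hδ₂
  have e₁ := h₁.scaling hℓ hc₁ (r := δ / 4) (r' := δ / 2) (by linarith) (by linarith)
    (by linarith [min_le_left δ₁ δ₂])
  have e₂ := h₂.scaling hℓ hc₂ (r := δ / 4) (r' := δ / 2) (by linarith) (by linarith)
    (by linarith [min_le_right δ₁ δ₂])
  have hcc : c₁ = c₂ := by
    have h3 : (c₁ - c₂) * δ ^ 2 = 0 := by linear_combination (16 / 3) * e₁ - (16 / 3) * e₂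
    exact sub_eq_zero.1 ((mul_eq_zero.1 h3).resolve_right (pow_pos hδ0 2).ne')
  refine ⟨δ, hδ0, ?_⟩
  filter_upwards [hc₁, hc₂] with x hx hx' hm
  rw [hx ⟨hm.1, hm.2.trans_le (min_le_left _ _)⟩, hx' ⟨hm.1, hm.2.trans_le (min_le_right _ _)⟩, hcc]

/-- Continuous induction for almost everywhere statements on the half-line. -/
lemma ae_Ioi_of_extend {P : ℝ → Prop} (h0 : ∃ δ, 0 < δ ∧ ∀ᵐ x, x ∈ Ioo 0 δ → P x)
    (hstep : ∀ R, 0 < R → (∀ᵐ x, x ∈ Ioo 0 R → P x) →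
      ∃ β, R < β ∧ ∀ᵐ x, x ∈ Ioo 0 β → P x) :
    ∀ᵐ x, x ∈ Ioi (0 : ℝ) → P x := by
  set S : Set ℝ := {b | ∀ᵐ x, x ∈ Ioo 0 b → P x} with hS
  have hdown : ∀ a b, a ≤ b → b ∈ S → a ∈ S := by
    intro a b hab hb
    have hb' : ∀ᵐ x, x ∈ Ioo 0 b → P x := hb
    change ∀ᵐ x, x ∈ Ioo 0 a → P x
    filter_upwards [hb'] with x hx hm using hx ⟨hm.1, hm.2.trans_le hab⟩
  obtain ⟨δ, hδ, hδS⟩ := h0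
  have hall : ∀ b, b ∈ S := by
    intro b
    by_contra hb
    have hbdd : BddAbove S := ⟨b, fun a ha => by
      by_contra! hlt
      exact hb (hdown b a hlt.le ha)⟩
    have hR : 0 < sSup S := hδ.trans_le (le_csSup hbdd hδS)
    have hmem : sSup S ∈ S := by
      -- The supremum is attained because `(0, sSup S)` is a countable union of intervals on which
      -- `P` holds almost everywhere.
      have hk : ∀ k : ℕ, ∀ᵐ x, x ∈ Ioo 0 (sSup S - 1 / ((k : ℝ) + 1)) → P x := by
        intro k
        obtain ⟨a, ha, hlt⟩ := exists_lt_of_lt_csSup ⟨δ, hδS⟩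
          (sub_lt_self (sSup S) (Nat.one_div_pos_of_nat (α := ℝ) (n := k)))
        exact hdown _ a hlt.le ha
      change ∀ᵐ x, x ∈ Ioo 0 (sSup S) → P x
      filter_upwards [ae_all_iff.2 hk] with x hx hm
      obtain ⟨k, hk⟩ := exists_nat_one_div_lt (sub_pos.2 hm.2)
      exact hx k ⟨hm.1, by linarith⟩
    obtain ⟨β, hβ, hβS⟩ := hstep _ hR hmem
    exact absurd (le_csSup hbdd hβS) (not_le.2 hβ)
  have hall' : ∀ k : ℕ, ∀ᵐ x, x ∈ Ioo (0 : ℝ) k → P x := fun k => hall k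
  filter_upwards [ae_all_iff.2 hall'] with x hx hm
  obtain ⟨k, hk⟩ := exists_nat_gt x
  exact hx k ⟨hm, hk⟩

end

end FixedEll


theorem mainTheorem2 (ℓ : ℝ) (hℓ : -1 / 2 ≤ ℓ) (V₁ V₂ : ℝ → ℝ)
    (hV₁ : FixedEll.IntegrabilityConditions V₁) (hV₂ : FixedEll.IntegrabilityConditions V₂)
    (hc₁ : FixedEll.ConstantNearZero V₁) (hc₂ : FixedEll.ConstantNearZero V₂)
    (n₁ n₂ : ℕ) (hn₁ : 1 ≤ n₁) (hn₂ : 1 ≤ n₂)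
    (hcoincide : FixedEll.lineOfZeros V₁ ℓ n₁ = FixedEll.lineOfZeros V₂ ℓ n₂)
    (hsweep₁ : FixedEll.SweepsPositiveAxis (FixedEll.lineOfZeros V₁ ℓ n₁))
    (hsweep₂ : FixedEll.SweepsPositiveAxis (FixedEll.lineOfZeros V₂ ℓ n₂)) :
    ∀ᵐ r ∂(MeasureTheory.volume.restrict (Set.Ioi (0 : ℝ))), V₁ r = V₂ r := by
  have hE : ∀ r : ℝ, 0 < r → ∃ E, (E, r) ∈ FixedEll.lineOfZeros V₁ ℓ n₁ := by
    intro r hr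
    have : r ∈ Prod.snd '' FixedEll.lineOfZeros V₁ ℓ n₁ := by rw [hsweep₁]; exact hr
    obtain ⟨⟨E, r'⟩, hp, rfl⟩ := this
    exact ⟨E, hp⟩
  -- The same function `E` serves both potentials because the lines coincide as sets of pairs; the
  -- indices `n₁` and `n₂` may differ.
  choose! E hE using hE
  have hE₂ : ∀ r : ℝ, 0 < r → (E r, r) ∈ FixedEll.lineOfZeros V₂ ℓ n₂ := fun r hr => by
    rw [← hcoincide]; exact hE r hr
  choose! ψ₁ h₁ using hE
  choose! ψ₂ h₂ using hE₂
  rw [ae_restrict_iff' measurableSet_Ioi]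
  exact FixedEll.ae_Ioi_of_extend (FixedEll.exists_ae_eq_near_zero hℓ hc₁ hc₂ h₁ h₂)
    (fun R hR heq => FixedEll.exists_ae_eq_extend hℓ hV₁ hV₂ h₁ h₂ hR heq)
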